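/- For a finite graph $G$ without isolated vertices let $\varphi(G)$ be the monotone 2-CNF with variables $V(G)$ and a clause $(u\vee v)$ for each edge $\{u,v\}$ of $G$, and let $obdd(\varphi(G))$ be the smallest number of nodes of an ordered binary decision diagram (OBDD) representing $\varphi(G)$. For $U\subseteq V(G)$ let $G^U$ be the graph obtained from $G$ by removing all edges with both ends outside $U$. The lu-mim width $lu(G)$ is the minimum, over all orderings $v_1,\dots,v_n$ of $V(G)$, of the maximum over $1\le i\le n$ of the largest size of an induced matching of $G^{V_i}$ all of whose edges join $V_i$ to $V(G)\setminus V_i$, where $V_i=\{v_1,\dots,v_i\}$. For $p,q,r\ge 1$ the $p,q,r$-grid of skewed graphs has main vertices $x_{i,k,j}$ with $1\le i\le p$, $1\le k\le r$, $1\le j\le q$, and the edges $\{x_{i,k,j},x_{i+1,k,j'}\}$ for $j\le j'$; moreover, for each $i$, the vertices $x_{i,1,1},\dots,x_{i,1,q},x_{i,2,1},\dots,x_{i,r,q}$ are connected in this order by a path, each edge of which is subdivided by one additional vertex. Then the following holds, where $n$ is the number of vertices of the graph considered and all constants implied by $\Theta,O,\Omega$ in 1 and 2 are absolute. 1. For all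 $r\ge1$ and $p\ge\max(r,2)$, the $p\times r$ grid $G$ satisfies $lu(G)=\Theta(r)$ and $obdd(\varphi(G))\le n\cdot 2^{O(r)}$; in particular $obdd(\varphi(G))\le 2^{O(r)}$ if moreover $p\le 2^r$. 2. For every $r\ge1$, all sufficiently large $q$ (depending on $r$) and $p=2r\lceil\log_2 q\rceil$, the $p,q,r$-grid $G$ of skewed graphs satisfies $lu(G)=\Theta(r)$ and $obdd(\varphi(G))\ge n^{\Omega(r)}$. 3. Hence neither bound in $2^{lu(G)}\le obdd(\varphi(G))\le n^{O(lu(G))}$ can be improved in terms of $lu(G)$. There is a constant $C>0$ such that, if $f:\mathbb N\to\mathbb R$ satisfies $2^{f(lu(G))}\le obdd(\varphi(G))$ for all nonempty finite graphs $G$ without isolated vertices, then $f(k)\le Ck$ for infinitely many $k$. There is a constant $c>0$ such that, if $g:\mathbb N\to\mathbb R$ satisfies $obdd(\varphi(G))\le n^{g(lu(G))}$ for all such $G$, then $g(k)\ge ck$ for infinitely many $k$. -/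

import Mathlib

/-- The monotone 2-CNF `φ(G)` with a clause `(u ∨ v)` for each edge `{u, v}` of `G`, as a
predicate on the assignments of its variables, the vertices of `G`. -/
def SatCNF {V : Type*} (G : SimpleGraph V) (S : V → Bool) : Prop :=
  ∀ u v : V, G.Adj u v → S u = true ∨ S v = true

/-- What a node of a decision diagram carries: either it is a sink labelled with a truth value, or
it is labelled with a variable `x` and has two outgoing edges, `child true` being the head of the
edge labelled with the literal `x` and `child false` the head of the edge labelled with `¬ x`. -/
inductive NodeData (X N : Type*) where
  | sink (b : Bool) : NodeData X N
  | decision (x : X) (child : Bool → N) : NodeData X N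

/-- An ordered binary decision diagram with set of nodes `N` and variables in `X`. -/
structure OBDD (X N : Type*) where
  node : N → NodeData X N
  source : N
  /-- The source is the one and only node without incoming edges. -/
  source_unique : ∀ v : N,
    (∀ (u : N) (x : X) (child : Bool → N) (b : Bool),
      node u = NodeData.decision x child → child b ≠ v) ↔ v = source
  /-- There are exactly two sinks, one labelled with true and one labelled with false. -/
  sink_unique : ∀ b : Bool, ∃! v : N, node v = NodeData.sink b
  /-- The two outgoing neighbours of a non-sink node are distinct. -/
  child_ne : ∀ (u : N) (x : X) (child : Bool → N),
    node u = NodeData.decision x child → child true ≠ child false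
  /-- Some linear order of the variables increases strictly along each edge between two non-sink
  nodes, hence along each path between two such nodes. -/
  ordered : ∃ ord : LinearOrder X, ∀ (u v : N) (x y : X) (cu cv : Bool → N) (b : Bool),
    node u = NodeData.decision x cu → node v = NodeData.decision y cv → cu b = v → ord.lt x y

namespace OBDD

variable {X N : Type*}

/-- There is an edge from `u` to `v`. -/
def Edge (Z : OBDD X N) (u v : N) : Prop :=
  ∃ (x : X) (child : Bool → N) (b : Bool), Z.node u = NodeData.decision x child ∧ child b = v

/-- There is an edge from `u` to `v` whose literal is satisfied by the assignment `S`. -/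
def Step (Z : OBDD X N) (S : X → Bool) (u v : N) : Prop :=
  ∃ (x : X) (child : Bool → N), Z.node u = NodeData.decision x child ∧ child (S x) = v

/-- The Boolean function represented by `Z`: there is a path from the source to the true sink
all of whose literals belong to the assignment `S`. -/
def Accepts (Z : OBDD X N) (S : X → Bool) : Prop :=
  ∃ t : N, Z.node t = NodeData.sink true ∧ Relation.ReflTransGen (Z.Step S) Z.source t

/-- Being ordered and read-once, for paths: along any path the variables are strictly increasing,
so no variable occurs twice. -/
theorem path_lt (Z : OBDD X N) : ∃ ord : LinearOrder X, ∀ (u v : N),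
    Relation.TransGen Z.Edge u v → ∀ (x y : X) (cu cv : Bool → N),
    Z.node u = NodeData.decision x cu → Z.node v = NodeData.decision y cv → ord.lt x y := by
  obtain ⟨ord, h⟩ := Z.ordered
  refine ⟨ord, fun u v huv => ?_⟩
  induction huv with
  | single e =>
    intro x y cu cv hu hv
    obtain ⟨x', c, b, h1, h2⟩ := e
    rw [hu] at h1
    cases h1
    exact h _ _ _ _ _ _ b hu hv h2
  | tail _ e ih =>
    intro x y cu cv hu hv
    obtain ⟨z, c, b, h1, h2⟩ := e
    exact @lt_trans X ord.toPartialOrder.toPreorder x z y (ih x z cu c hu h1)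
      (h _ _ _ _ _ _ b h1 hv h2)

/-- A diagram has no directed cycle. -/
theorem acyclic (Z : OBDD X N) (u : N) : ¬ Relation.TransGen Z.Edge u u := by
  intro huu
  obtain ⟨ord, h⟩ := Z.path_lt
  obtain ⟨v, e, _⟩ := Relation.TransGen.head'_iff.mp huu
  obtain ⟨x, c, b, h1, _⟩ := e
  exact (@lt_irrefl X ord.toPartialOrder.toPreorder x) (h u u huu x x c c h1 h1)

end OBDD

/-- The sizes (numbers of nodes) of the OBDDs that represent `φ(G)`. -/
def obddSizes {V : Type*} (G : SimpleGraph V) : Set ℕ :=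
  {m | ∃ Z : OBDD V (Fin m), ∀ S : V → Bool, Z.Accepts S ↔ SatCNF G S}

/-- The smallest size of an OBDD that represents `φ(G)`. -/
noncomputable def obdd {V : Type*} (G : SimpleGraph V) : ℕ :=
  sInf (obddSizes G)

/-- The upper subgraph `G^U`: the edges of `G` with both ends outside `U` are removed. -/
def upperSubgraph {V : Type*} (G : SimpleGraph V) (U : Set V) : SimpleGraph V where
  Adj u v := G.Adj u v ∧ (u ∈ U ∨ v ∈ U)
  symm := ⟨fun _ _ h => ⟨h.1.symm, h.2.symm⟩⟩
  loopless := ⟨fun _ h => h.1.ne rfl⟩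

/-- `M` is an induced `(U, V(H) \ U)`-matching of `H`; an edge of `M` is written as the pair of its
end in `U` and its end outside `U`. -/
def IsInducedCutMatching {V : Type*} (H : SimpleGraph V) (U : Set V) (M : Finset (V × V)) : Prop :=
  (∀ e ∈ M, e.1 ∈ U ∧ e.2 ∉ U ∧ H.Adj e.1 e.2) ∧
  ∀ e ∈ M, ∀ f ∈ M, e ≠ f →
    e.1 ≠ f.1 ∧ e.2 ≠ f.2 ∧
    ¬ H.Adj e.1 f.1 ∧ ¬ H.Adj e.2 f.2 ∧ ¬ H.Adj e.1 f.2 ∧ ¬ H.Adj e.2 f.1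

/-- The largest size of an induced `(U, V(G) \ U)`-matching of `G^U`. -/
noncomputable def upperMim {V : Type*} (G : SimpleGraph V) (U : Set V) : ℕ :=
  sSup {k | ∃ M : Finset (V × V), IsInducedCutMatching (upperSubgraph G U) U M ∧ M.card = k}

/-- The width of a permutation of the vertices: the largest `upperMim` of its nonempty prefixes. -/
noncomputable def permWidth {V : Type*} [Fintype V] (G : SimpleGraph V)
    (π : Fin (Fintype.card V) ≃ V) : ℕ :=
  Finset.univ.sup fun i : Fin (Fintype.card V) => upperMim G (π '' {j | j ≤ i})

/-- The linear upper induced matching width (lu-mim width) of `G`: the smallest width of a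
permutation of the vertices. -/
noncomputable def lu {V : Type*} [Fintype V] (G : SimpleGraph V) : ℕ :=
  ⨅ π : Fin (Fintype.card V) ≃ V, permWidth G π

/-- The `p × r` grid. -/
def gridGraph (p r : ℕ) : SimpleGraph (Fin p × Fin r) :=
  SimpleGraph.boxProd (SimpleGraph.pathGraph p) (SimpleGraph.pathGraph r)

/-- The vertices of the `p,q,r`-grid of skewed graphs. `main i k j` is the `j`-th vertex of the
`i`-th layer of the `k`-th path of skewed graphs; with indices starting from `0`, its coordinate in
the layer is `k * q + j`. `aux i d` is the vertex that subdivides the edge between the main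
vertices of coordinates `d` and `d + 1` of the `i`-th layer. -/
abbrev SkewVertex (p q r : ℕ) : Type :=
  (Fin p × Fin r × Fin q) ⊕ (Fin p × Fin (r * q - 1))

/-- One orientation of each edge of the `p,q,r`-grid of skewed graphs. -/
def skewRel (p q r : ℕ) : SkewVertex p q r → SkewVertex p q r → Prop
  | Sum.inl (i, k, j), Sum.inl (i', k', j') => i.val + 1 = i'.val ∧ k = k' ∧ j ≤ j'
  | Sum.inl (i, k, j), Sum.inr (i', d) =>
      i = i' ∧ (k.val * q + j.val = d.val ∨ k.val * q + j.val = d.val + 1)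
  | Sum.inr _, _ => False

/-- The `p,q,r`-grid of skewed graphs: `r` disjoint `p,q`-paths of skewed graphs (consecutive layers
`u_1, …, u_q` and `v_1, …, v_q` of such a path are joined by the edges `{u_i, v_j}`, `i ≤ j`),
where for each `i` the main vertices of the `i`-th layers of all of them are connected, in the
order of their coordinates, into a path, each edge of which is subdivided once. -/
def skewGrid (p q r : ℕ) : SimpleGraph (SkewVertex p q r) :=
  SimpleGraph.fromRel (skewRel p q r)

/-! Assignments of a prefix `U` of the variable order that leave different subfunctions must lead to
different nodes. Conversely, the subfunctions themselves are the nodes of a diagram (`reducedOBDD`).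
So, for a fixed order, size is a matter of counting subfunctions. For `φ(G)`, setting an independent
set `A ⊆ U` to false and the rest of `U` to true forces exactly the neighbours of `A` outside `U` to
be true. Independent sets with different outer neighbourhoods are therefore counted from below
(`exists_perm_card_le_of_mem_obddSizes`). From above, only prefix vertices with outer neighbours
matter (`obdd_le_of_boundary`).

In the grid, the row-major order leaves at most `r` such vertices, which bounds both width and size.
For any order, stop when the first row or column is complete: the lines that cross it are cut,
except possibly the one through the last vertex, and every second one contributes an edge of an
induced matching.

A skewed graph has no induced matching with two edges, yet all its left vertices have different
neighbourhoods. This is the gap between width and size: the layer-by-layer order has width at most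
`2r + 1`, while `r` skewed graphs of order `w` across one prefix give `w ^ r` subfunctions. Such a
prefix is found in `exists_prefix_skewGrid`: stop when the first layer is full. If `U` separates at
least `T` consecutive pairs inside layers, the subdivided paths yield an induced matching of size `T
/ 4`, hence `2 ^ (T / 4)` subfunctions. Otherwise some layer is disjoint from `U`, and each path of
skewed graphs has a block of `w` coordinates on which no layer changes sides, so a skewed graph of
order `w` crosses `U` between the full and the empty layer. For large `q`, taking `T = r * Nat.clog
2 q` and `w = Nat.sqrt q` makes both counts `n ^ Ω(r)`. The two families then show that both general
bounds are optimal. -/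

namespace OBDD

/-! ### Lower bounds for diagrams by counting subfunctions. -/

variable {X N : Type*}

theorem Step.edge {Z : OBDD X N} {S : X → Bool} {u v : N} (h : Z.Step S u v) : Z.Edge u v := by
  obtain ⟨x, c, h1, h2⟩ := h
  exact ⟨x, c, S x, h1, h2⟩

theorem step_rightUnique (Z : OBDD X N) (S : X → Bool) : Relator.RightUnique (Z.Step S) := by
  rintro u v w ⟨x, c, h1, h2⟩ ⟨y, d, h3, h4⟩
  rw [h1] at h3
  cases h3
  rw [← h2, ← h4]

theorem wellFounded_edge [Finite N] (Z : OBDD X N) : WellFounded fun v u => Z.Edge u v := by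
  have : IsTrans N fun v u => Relation.TransGen Z.Edge u v := ⟨fun _ _ _ h1 h2 => h2.trans h1⟩
  have : Std.Irrefl fun v u => Relation.TransGen Z.Edge u v := ⟨fun u h => Z.acyclic u h⟩
  exact Subrelation.wf (fun h => Relation.TransGen.single h)
    (Finite.wellFounded_of_trans_of_irrefl fun v u => Relation.TransGen Z.Edge u v)

/-- A path along `S` can be followed until it leaves the variables in `U`. -/
theorem exists_exit [Finite N] (Z : OBDD X N) (S : X → Bool) (U : Set X) (u : N) :
    ∃ v, Relation.ReflTransGen (fun u v => ∃ x c, Z.node u = NodeData.decision x c ∧ x ∈ U ∧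
        c (S x) = v) u v ∧
      ∀ x c, Z.node v = NodeData.decision x c → x ∉ U := by
  induction u using Z.wellFounded_edge.induction with
  | _ u ih =>
    by_cases h : ∃ x c, Z.node u = NodeData.decision x c ∧ x ∈ U
    · obtain ⟨x, c, h1, h2⟩ := h
      obtain ⟨v, h3, h4⟩ := ih (c (S x)) ⟨x, c, S x, h1, rfl⟩
      exact ⟨v, Relation.ReflTransGen.head ⟨x, c, h1, h2, rfl⟩ h3, h4⟩
    · push Not at h
      exact ⟨u, Relation.ReflTransGen.refl, h⟩

open Classical in
/-- For a family of assignments of a prefix `U` that yield pairwise different functions of the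
remaining variables, a diagram has at least as many nodes as the family has members. -/
theorem card_le_of_subfunctions_ne [Fintype N] (Z : OBDD X N) :
    ∃ ord : LinearOrder X, ∀ {ι : Type*} [Fintype ι] (U : Set X), (∀ x y, ord.lt x y → y ∈ U → x ∈ U) →
      ∀ A : ι → X → Bool, (∀ i j, i ≠ j → ∃ S, ¬ (Z.Accepts (U.piecewise (A i) S) ↔
        Z.Accepts (U.piecewise (A j) S))) → Fintype.card ι ≤ Fintype.card N := by
  obtain ⟨ord, hord⟩ := Z.path_lt
  refine ⟨ord, fun {ι} _ U hU A hA => ?_⟩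
  -- `v i` is the node at which the path of `A i` leaves the variables in `U`; these nodes will turn
  -- out to be distinct.
  choose v hv1 hv2 using fun i => Z.exists_exit (A i) U Z.source
  have key : ∀ i S, Z.Accepts (U.piecewise (A i) S) ↔
      ∃ t, Z.node t = NodeData.sink true ∧ Relation.ReflTransGen (Z.Step S) (v i) t := by
    intro i S
    have h1 : Relation.ReflTransGen (Z.Step (U.piecewise (A i) S)) Z.source (v i) := by
      refine Relation.ReflTransGen.mono ?_ _ _ (hv1 i)
      rintro a b ⟨x, c, h1, h2, h3⟩
      exact ⟨x, c, h1, by rw [Set.piecewise_eq_of_mem _ _ _ h2, h3]⟩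
    -- Variables increase along paths and `U` is a prefix, so no variable of `U` is read from `v i`
    -- on.
    have h2 : ∀ w, Relation.ReflTransGen Z.Edge (v i) w → ∀ b,
        Z.Step (U.piecewise (A i) S) w b ↔ Z.Step S w b := by
      intro w hw b
      have : ∀ x c, Z.node w = NodeData.decision x c → x ∉ U := by
        rcases Relation.reflTransGen_iff_eq_or_transGen.mp hw with rfl | hw
        · exact hv2 i
        · intro x c hx hxU
          obtain ⟨y, ⟨z, d, _, h4, _⟩, _⟩ := Relation.TransGen.head'_iff.mp hw
          exact hv2 i z d h4 (hU z x (hord _ _ hw z x d c h4 hx) hxU)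
      constructor
      · rintro ⟨x, c, h3, h4⟩
        exact ⟨x, c, h3, by rwa [Set.piecewise_eq_of_notMem _ _ _ (this x c h3)] at h4⟩
      · rintro ⟨x, c, h3, h4⟩
        exact ⟨x, c, h3, by rwa [Set.piecewise_eq_of_notMem _ _ _ (this x c h3)]⟩
    have h3 : ∀ t, Relation.ReflTransGen (Z.Step (U.piecewise (A i) S)) (v i) t ↔
        Relation.ReflTransGen (Z.Step S) (v i) t := by
      intro t
      constructor
      · intro h
        induction h with
        | refl => exact .refl
        | tail h4 h5 ih =>
          exact ih.tail ((h2 _ (Relation.ReflTransGen.mono (fun _ _ h => h.edge) _ _ h4) _).mp h5)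
      · intro h
        induction h with
        | refl => exact .refl
        | tail h4 h5 ih =>
          exact ih.tail ((h2 _ (Relation.ReflTransGen.mono (fun _ _ h => h.edge) _ _ h4) _).mpr h5)
    constructor
    · rintro ⟨t, ht, h4⟩
      refine ⟨t, ht, (h3 t).mp ?_⟩
      -- The path of an assignment is unique and cannot continue beyond a sink, so it reaches `v i`
      -- before the sink.
      rcases Relation.ReflTransGen.total_of_right_unique (Z.step_rightUnique _) h1 h4 with h | h
      · exact h
      · rcases Relation.ReflTransGen.cases_head h with h | ⟨c, ⟨x, d, h5, _⟩, _⟩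
        · rw [h]
        · rw [ht] at h5
          cases h5
    · rintro ⟨t, ht, h4⟩
      exact ⟨t, ht, h1.trans ((h3 t).mpr h4)⟩
  refine Fintype.card_le_of_injective v fun i j hij => ?_
  by_contra hne
  obtain ⟨S, hS⟩ := hA i j hne
  exact hS (by rw [key, key, hij])

end OBDD

theorem exists_equiv_image_Iic {V : Type*} [Fintype V] (ord : LinearOrder V) :
    ∃ π : Fin (Fintype.card V) ≃ V, ∀ i, π '' {j | j ≤ i} = {v | ord.le v (π i)} := by
  let _ := ord
  refine ⟨(Fintype.orderIsoFinOfCardEq V rfl).toEquiv, fun i => ?_⟩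
  ext v
  obtain ⟨j, rfl⟩ := (Fintype.orderIsoFinOfCardEq V rfl).surjective v
  simp only [Set.mem_image, Set.mem_ofPred_eq]
  constructor
  · rintro ⟨k, hk, h⟩
    have := (Fintype.orderIsoFinOfCardEq V rfl).monotone hk
    rw [← h]
    exact this
  · intro h
    exact ⟨j, (Fintype.orderIsoFinOfCardEq V rfl).le_iff_le.mp h, rfl⟩

/-- For some ordering of the variables of a diagram for `φ(G)`, the number of nodes bounds the
number of independent subsets of a prefix with different neighbourhoods outside the prefix. -/
theorem exists_perm_card_le_of_mem_obddSizes {V : Type*} [Fintype V] {G : SimpleGraph V} {m : ℕ}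
    (hm : m ∈ obddSizes G) :
    ∃ π : Fin (Fintype.card V) ≃ V, ∀ (i : Fin (Fintype.card V)) {ι : Type*} [Fintype ι] (A : ι → Set V),
      (∀ t, A t ⊆ π '' {j | j ≤ i}) → (∀ t, ∀ u ∈ A t, ∀ v ∈ A t, ¬ G.Adj u v) →
      (∀ s t, s ≠ t → ∃ v ∉ π '' {j | j ≤ i},
        ¬ ((∃ u ∈ A s, G.Adj u v) ↔ ∃ u ∈ A t, G.Adj u v)) →
      Fintype.card ι ≤ m := by
  classical
  obtain ⟨Z, hZ⟩ := hm
  obtain ⟨ord, h⟩ := Z.card_le_of_subfunctions_ne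
  obtain ⟨π, hπ⟩ := exists_equiv_image_Iic ord
  refine ⟨π, fun i _ _ A hAU hind hA => ?_⟩
  rw [hπ] at hAU hA
  have h1 := h {v | ord.le v (π i)}
    (fun x y hxy hy => ord.le_trans _ _ _ (@le_of_lt _ ord.toPreorder _ _ hxy) hy)
    (fun t v => decide (v ∉ A t)) ?_
  · simpa using h1
  intro s t hst
  obtain ⟨v, hv, hne⟩ := hA s t hst
  -- Outside the prefix only `v` is false, so the formula fails exactly when `v` has a neighbour in
  -- the independent set.
  refine ⟨fun w => decide (w ≠ v), fun hiff => hne ?_⟩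
  rw [hZ, hZ] at hiff
  have key : ∀ s (_ : ∀ w, Decidable (w ∈ {v | ord.le v (π i)})), SatCNF G (Set.piecewise {v | ord.le v (π i)} (fun v => decide (v ∉ A s))
      fun w => decide (w ≠ v)) ↔ ¬ ∃ u ∈ A s, G.Adj u v := by
    intro s _
    have hval : ∀ w, Set.piecewise {v | ord.le v (π i)} (fun v => decide (v ∉ A s))
        (fun w => decide (w ≠ v)) w = true ↔ w ∉ A s ∧ w ≠ v := by
      intro w
      by_cases hw : w ∈ {v | ord.le v (π i)}
      · rw [Set.piecewise_eq_of_mem _ _ _ hw]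
        have : w ≠ v := fun h => hv (h ▸ hw)
        simp [this]
      · rw [Set.piecewise_eq_of_notMem _ _ _ hw]
        have : w ∉ A s := fun h => hw (hAU s h)
        simp [this]
    constructor
    · rintro h ⟨u, hu, huv⟩
      rcases h u v huv with h | h
      · exact ((hval _).mp h).1 hu
      · exact ((hval _).mp h).2 rfl
    · intro h x y hxy
      rw [hval, hval]
      by_contra hcon
      push Not at hcon
      have hor : ∀ w, (w ∉ A s → w = v) → w ∈ A s ∨ w = v := fun w hw => by tauto
      rcases hor x hcon.1 with hx | rfl <;> rcases hor y hcon.2 with hy | rfl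
      · exact hind s x hx y hy hxy
      · exact h ⟨x, hx, hxy⟩
      · exact h ⟨y, hy, hxy.symm⟩
      · exact hxy.ne rfl
  rw [key, key] at hiff
  exact not_iff_not.mp hiff

/-! ### Renaming nodes, to pass from an arbitrary finite node type to `Fin m`. -/

/-- Transport of the successors along a map of the nodes. -/
def NodeData.map {X N N' : Type*} (g : N → N') : NodeData X N → NodeData X N'
  | NodeData.sink b => NodeData.sink b
  | NodeData.decision x c => NodeData.decision x (g ∘ c)

theorem NodeData.map_eq_sink {X N N' : Type*} {g : N → N'} {d : NodeData X N} {b : Bool} :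
    d.map g = NodeData.sink b ↔ d = NodeData.sink b := by
  cases d <;> simp [NodeData.map]

theorem NodeData.map_eq_decision {X N N' : Type*} (e : N ≃ N') {d : NodeData X N} {x : X}
    {c : Bool → N'} : d.map e = NodeData.decision x c ↔ d = NodeData.decision x (e.symm ∘ c) := by
  cases d with
  | sink b => simp [NodeData.map]
  | decision y c' =>
    simp only [NodeData.map, NodeData.decision.injEq]
    refine and_congr_right fun _ => ⟨?_, ?_⟩
    · rintro rfl
      ext b
      simp
    · rintro rfl
      ext b
      simp

namespace OBDD

variable {X N N' : Type*}

/-- Renaming the nodes of a diagram. -/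
def mapEquiv (Z : OBDD X N) (e : N ≃ N') : OBDD X N' where
  node v := (Z.node (e.symm v)).map e
  source := e Z.source
  source_unique v := by
    rw [← e.symm_apply_eq, ← Z.source_unique]
    constructor
    · intro h u x c b hu hc
      refine h (e u) x (e ∘ c) b ?_ ?_
      · rw [NodeData.map_eq_decision, e.symm_apply_apply, hu]
        congr 1
        ext b
        simp
      · simp [hc]
    · intro h u x c b hu hc
      rw [NodeData.map_eq_decision] at hu
      exact h _ x _ b hu (by simp [hc])
  sink_unique b := by
    obtain ⟨v, hv, huniq⟩ := Z.sink_unique b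
    refine ⟨e v, NodeData.map_eq_sink.mpr (by simpa using hv), fun w hw => ?_⟩
    rw [← huniq (e.symm w) (NodeData.map_eq_sink.mp hw), e.apply_symm_apply]
  child_ne u x c h := by
    rw [NodeData.map_eq_decision] at h
    exact fun heq => Z.child_ne _ _ _ h (by simp [heq])
  ordered := by
    obtain ⟨ord, h⟩ := Z.ordered
    refine ⟨ord, fun u v x y cu cv b hu hv huv => ?_⟩
    rw [NodeData.map_eq_decision] at hu hv
    exact h _ _ x y _ _ b hu hv (by simp [huv])

theorem mapEquiv_accepts (Z : OBDD X N) (e : N ≃ N') (S : X → Bool) :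
    (Z.mapEquiv e).Accepts S ↔ Z.Accepts S := by
  constructor
  · rintro ⟨t, ht, h⟩
    refine ⟨e.symm t, NodeData.map_eq_sink.mp ht, ?_⟩
    have := Relation.ReflTransGen.lift (p := Z.Step S) e.symm ?_ _ _ h
    · simpa [mapEquiv, Function.onFun] using this
    · rintro a b ⟨x, c, h1, h2⟩
      refine ⟨x, _, (NodeData.map_eq_decision e).mp h1, by simp [h2]⟩
  · rintro ⟨t, ht, h⟩
    refine ⟨e t, NodeData.map_eq_sink.mpr (by simpa using ht), ?_⟩
    refine Relation.ReflTransGen.lift (p := (Z.mapEquiv e).Step S) e ?_ _ _ h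
    rintro a b ⟨x, c, h1, h2⟩
    refine ⟨x, e ∘ c, ?_, by simp [h2]⟩
    simp only [mapEquiv, e.symm_apply_apply, h1, NodeData.map]

end OBDD

theorem card_mem_obddSizes {V N : Type*} [Fintype N] {G : SimpleGraph V} (Z : OBDD V N)
    (hZ : ∀ S, Z.Accepts S ↔ SatCNF G S) : Fintype.card N ∈ obddSizes G :=
  ⟨Z.mapEquiv (Fintype.equivFin N), fun S => by rw [Z.mapEquiv_accepts, hZ]⟩

/-! ### The reduced diagram, whose nodes are the subfunctions. -/

section Reduced

variable {V : Type*} {n : ℕ}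

/-- The function obtained from `F` by fixing the first `i` variables as in `a`. -/
def subfunction (e : V ≃ Fin n) (F : (V → Bool) → Prop) (i : ℕ) (a : V → Bool) :
    (V → Bool) → Prop :=
  fun S => F fun v => if (e v).val < i then a v else S v

variable (e : V ≃ Fin n) (F : (V → Bool) → Prop)

theorem subfunction_zero (a : V → Bool) : subfunction e F 0 a = F := by
  funext S
  simp [subfunction]

theorem subfunction_top (a S : V → Bool) : subfunction e F n a S = F a := by
  simp [subfunction]

theorem subfunction_self (i : ℕ) (a : V → Bool) : subfunction e F i a a = F a := by
  simp [subfunction]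

theorem subfunction_update [DecidableEq V] {i : ℕ} (h : i < n) (a : V → Bool) (b : Bool) :
    subfunction e F (i + 1) (Function.update a (e.symm ⟨i, h⟩) b) =
      fun S => subfunction e F i a (Function.update S (e.symm ⟨i, h⟩) b) := by
  funext S
  unfold subfunction
  congr 1
  funext v
  by_cases hv : v = e.symm ⟨i, h⟩
  · subst hv
    simp
  · have : (e v).val ≠ i := fun h' => hv (by rw [e.eq_symm_apply]; exact Fin.ext h')
    simp only [Function.update_of_ne hv]
    have : (e v).val < i + 1 ↔ (e v).val < i := by omega
    simp [this]

theorem subfunction_succ [DecidableEq V] {i : ℕ} (h : i < n) (a : V → Bool) :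
    subfunction e F (i + 1) a =
      fun S => subfunction e F i a (Function.update S (e.symm ⟨i, h⟩) (a (e.symm ⟨i, h⟩))) := by
  rw [← subfunction_update e F h, Function.update_eq_self]

theorem subfunction_congr {i : ℕ} (a : V → Bool) {S T : V → Bool}
    (h : ∀ v, i ≤ (e v).val → S v = T v) : subfunction e F i a S = subfunction e F i a T := by
  unfold subfunction
  congr 1
  funext v
  by_cases hv : (e v).val < i
  · simp [hv]
  · simp [hv, h v (by omega)]

theorem subfunction_update_of_lt [DecidableEq V] {i : ℕ} (a S : V → Bool) {x : V}
    (h : (e x).val < i) (b : Bool) :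
    subfunction e F i a (Function.update S x b) = subfunction e F i a S := by
  refine subfunction_congr e F a fun v hv => Function.update_of_ne ?_ _ _
  rintro rfl
  omega

/-- The subfunctions of `F` with respect to an order of the variables. -/
def subfunctions : Set ((V → Bool) → Prop) :=
  {f | ∃ i ≤ n, ∃ a, f = subfunction e F i a}

open Classical in
/-- The largest number of leading variables that can be fixed to obtain `f` from `F`. -/
noncomputable def subfunctionLevel (f : (V → Bool) → Prop) : ℕ :=
  Nat.findGreatest (fun i => ∃ a, f = subfunction e F i a) n

theorem subfunctionLevel_spec {f : (V → Bool) → Prop} (hf : f ∈ subfunctions e F) :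
    ∃ a, f = subfunction e F (subfunctionLevel e F f) a := by
  classical
  obtain ⟨i, hi, h⟩ := hf
  exact Nat.findGreatest_spec (P := fun i => ∃ a, f = subfunction e F i a) hi h

theorem le_subfunctionLevel {i : ℕ} (hi : i ≤ n) (a : V → Bool) :
    i ≤ subfunctionLevel e F (subfunction e F i a) :=
  open Classical in Nat.le_findGreatest hi ⟨a, rfl⟩

theorem subfunctionLevel_le (f : (V → Bool) → Prop) : subfunctionLevel e F f ≤ n :=
  open Classical in Nat.findGreatest_le n

open Classical in
-- The cofactor arises by fixing one more variable, and the level is the maximal number of fixed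
-- variables. This strict increase makes the diagram ordered.
theorem cofactor_mem {f : (V → Bool) → Prop} (hf : f ∈ subfunctions e F)
    (h : subfunctionLevel e F f < n) (b : Bool) :
    (fun S => f (Function.update S (e.symm ⟨_, h⟩) b)) ∈ subfunctions e F ∧
    subfunctionLevel e F f <
      subfunctionLevel e F (fun S => f (Function.update S (e.symm ⟨_, h⟩) b)) := by
  obtain ⟨a, ha⟩ := subfunctionLevel_spec e F hf
  have key : (fun S => f (Function.update S (e.symm ⟨_, h⟩) b)) =
      subfunction e F (subfunctionLevel e F f + 1)
        (Function.update a (e.symm ⟨subfunctionLevel e F f, h⟩) b) := by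
    rw [subfunction_update e F h]
    funext S
    exact congrFun ha _
  rw [key]
  exact ⟨⟨_, h, _, rfl⟩, le_subfunctionLevel e F h _⟩

open Classical in
/-- The label and the successors of a subfunction in the reduced diagram. -/
noncomputable def reducedNode (f : subfunctions e F) : NodeData V (subfunctions e F) :=
  if h : subfunctionLevel e F f.1 < n then
    NodeData.decision (e.symm ⟨_, h⟩) fun b =>
      ⟨fun S => f.1 (Function.update S (e.symm ⟨_, h⟩) b), (cofactor_mem e F f.2 h b).1⟩
  else NodeData.sink (decide (f.1 fun _ => true))

open Classical in
theorem reducedNode_eq_decision {f : subfunctions e F} {x : V} {c : Bool → subfunctions e F} :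
    reducedNode e F f = NodeData.decision x c ↔ (e x).val = subfunctionLevel e F f.1 ∧
      ∀ b, (c b).1 = fun S => f.1 (Function.update S x b) := by
  unfold reducedNode
  split_ifs with h
  · simp only [NodeData.decision.injEq]
    constructor
    · rintro ⟨rfl, rfl⟩
      simp
    · rintro ⟨h1, h2⟩
      have : x = e.symm ⟨_, h⟩ := by
        rw [e.eq_symm_apply]
        exact Fin.ext h1
      subst this
      refine ⟨rfl, ?_⟩
      funext b
      exact Subtype.ext (h2 b).symm
  · simp only [false_iff]
    rintro ⟨h1, -⟩
    exact h (h1 ▸ (e x).isLt)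

open Classical in
-- A constant subfunction also arises by fixing all `n` variables, so its maximal level is `n`;
-- conversely a function of level `n` is constant, and any assignment reads off its value.
theorem reducedNode_eq_sink {f : subfunctions e F} {b : Bool} :
    reducedNode e F f = NodeData.sink b ↔ f.1 = fun _ => (b = true) := by
  unfold reducedNode
  obtain ⟨f, hf⟩ := f
  split_ifs with h
  · simp only [false_iff]
    rintro rfl
    dsimp only at h
    obtain ⟨i, hi, a, ha⟩ := hf
    have h1 : (fun _ => (b = true)) = subfunction e F n a := by
      funext S
      rw [subfunction_top, ← subfunction_self e F i a, ← ha]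
    have := le_subfunctionLevel e F le_rfl a
    rw [← h1] at this
    omega
  · simp only [NodeData.sink.injEq]
    have h1 : subfunctionLevel e F f = n := le_antisymm (subfunctionLevel_le e F f) (not_lt.mp h)
    obtain ⟨a, ha⟩ := subfunctionLevel_spec e F hf
    rw [h1] at ha
    subst ha
    simp only [subfunction_top]
    constructor
    · rintro rfl
      funext S
      simp [subfunction_top]
    · intro h2
      have := congrFun h2 a
      rw [subfunction_top] at this
      simp [this]

open Classical in
-- Take the least number `i + 1` of fixed variables that yields `f`, and forget the last one. The
-- resulting function has level exactly `i`: otherwise it would ignore the next variable and equal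
-- `f`, against minimality.
theorem exists_reduced_parent {f : (V → Bool) → Prop} (hf : f ∈ subfunctions e F) (hne : f ≠ F) :
    ∃ (u : subfunctions e F) (x : V) (c : Bool → subfunctions e F) (b : Bool),
      reducedNode e F u = NodeData.decision x c ∧ (c b).1 = f := by
  have hex : ∃ i, i ≤ n ∧ ∃ a, f = subfunction e F i a := hf
  obtain ⟨hin, a, ha⟩ := Nat.find_spec hex
  have hmin : ∀ j < Nat.find hex, ∀ a, f ≠ subfunction e F j a := fun j hj a h =>
    Nat.find_min hex hj ⟨by omega, a, h⟩
  generalize Nat.find hex = i at *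
  obtain _ | i := i
  · rw [subfunction_zero] at ha
    exact absurd ha hne
  have hu : subfunction e F i a ∈ subfunctions e F := ⟨i, by omega, a, rfl⟩
  have hlevel : subfunctionLevel e F (subfunction e F i a) = i := by
    refine le_antisymm ?_ (le_subfunctionLevel e F (by omega) a)
    by_contra hlt
    obtain ⟨a', ha'⟩ := subfunctionLevel_spec e F hu
    refine hmin i (by omega) a ?_
    rw [ha, subfunction_succ e F hin]
    funext S
    rw [ha', subfunction_update_of_lt]
    simp only [Equiv.apply_symm_apply]
    omega
  have h : subfunctionLevel e F (subfunction e F i a) < n := by omega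
  refine ⟨⟨_, hu⟩, e.symm ⟨_, h⟩, fun b => ⟨_, (cofactor_mem e F hu h b).1⟩, a (e.symm ⟨_, h⟩), ?_, ?_⟩
  · rw [reducedNode_eq_decision]
    simp
  · simp only [hlevel]
    rw [ha, subfunction_succ e F hin]

open Classical in
/-- The reduced diagram of a function that is not constant. -/
noncomputable def reducedOBDD (hF : ∀ b : Bool, ∃ a, F a = (b = true)) :
    OBDD V (subfunctions e F) where
  node := reducedNode e F
  source := ⟨F, 0, Nat.zero_le _, fun _ => true, (subfunction_zero e F _).symm⟩
  source_unique v := by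
    constructor
    · intro h
      by_contra hne
      obtain ⟨u, x, c, b, h1, h2⟩ := exists_reduced_parent e F v.2 fun h => hne (Subtype.ext h)
      exact h u x c b h1 (Subtype.ext h2)
    -- If `F` is a successor of `u`, then `F` ignores all variables up to `x`. Hence `u` is `F` as
    -- well, and its level exceeds the position of `x`.
    · rintro rfl u x c b hu hc
      rw [reducedNode_eq_decision] at hu
      obtain ⟨a, ha⟩ := subfunctionLevel_spec e F u.2
      have h1 := hu.2 b
      rw [hc] at h1
      have h2 : subfunction e F ((e x).val + 1) (Function.update a x b) = F := by
        have := subfunction_update e F (e x).isLt a b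
        simp only [Fin.eta, Equiv.symm_apply_apply] at this
        rw [this]
        refine Eq.trans ?_ h1.symm
        funext S
        rw [hu.1, ← ha]
      have h3 : u.1 = F := by
        rw [ha, ← hu.1]
        conv_rhs => rw [← h2]
        funext S
        have : subfunction e F (e x).val a S =
          subfunction e F ((e x).val + 1) (Function.update a x b)
            (fun v => if (e v).val < (e x).val then a v else S v) := by rw [h2]; rfl
        rw [this]
        refine subfunction_congr e F _ fun v hv => ?_
        rw [if_neg (by omega)]
      have h4 := le_subfunctionLevel e F (e x).isLt (Function.update a x b)
      rw [h2] at h4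
      rw [h3] at hu
      omega
  sink_unique b := by
    obtain ⟨a, ha⟩ := hF b
    refine ⟨⟨subfunction e F n a, n, le_rfl, a, rfl⟩, ?_, fun w hw => ?_⟩
    · refine (reducedNode_eq_sink e F).mpr ?_
      funext S
      exact (subfunction_top e F a S).trans ha
    · replace hw := (reducedNode_eq_sink e F).mp hw
      refine Subtype.ext ?_
      rw [hw]
      funext S
      exact ((subfunction_top e F a S).trans ha).symm
  child_ne u x c h heq := by
    rw [reducedNode_eq_decision] at h
    obtain ⟨a, ha⟩ := subfunctionLevel_spec e F u.2
    -- If both successors agree, `u` does not depend on `x`, so `x` could be fixed too, against the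
    -- maximality of the level.
    have h1 : ∀ b S, u.1 (Function.update S x b) = u.1 S := by
      intro b S
      have h2 : ∀ b b', u.1 (Function.update S x b) = u.1 (Function.update S x b') := by
        have h3 : u.1 (Function.update S x true) = u.1 (Function.update S x false) := by
          have := h.2 true
          rw [heq, h.2 false] at this
          exact (congrFun this S).symm
        rintro (_ | _) (_ | _) <;> simp [h3]
      rw [h2 b (S x), Function.update_eq_self]
    have hlt : (e x).val < n := (e x).isLt
    have h4 : u.1 = subfunction e F ((e x).val + 1) a := by
      rw [subfunction_succ e F hlt]
      funext S
      simp only [Fin.eta, Equiv.symm_apply_apply]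
      rw [h.1, ← ha, h1]
    have h5 := le_subfunctionLevel e F hlt a
    rw [← h4] at h5
    omega
  ordered := by
    refine ⟨LinearOrder.lift' e e.injective, fun u v x y cu cv b hu hv huv => ?_⟩
    have hlt := cofactor_mem e F u.2
    rw [reducedNode_eq_decision] at hu hv
    have hx : e.symm ⟨_, hu.1 ▸ (e x).isLt⟩ = x := by
      rw [e.symm_apply_eq]
      exact Fin.ext hu.1.symm
    have := (hlt (hu.1 ▸ (e x).isLt) b).2
    rw [hx, ← hu.2 b, huv, ← hu.1, ← hv.1] at this
    exact this

theorem reducedOBDD_accepts [Finite V] (hF : ∀ b : Bool, ∃ a, F a = (b = true)) (S : V → Bool) :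
    (reducedOBDD e F hF).Accepts S ↔ F S := by
  classical
  have key : ∀ f : subfunctions e F, (∃ t, reducedNode e F t = NodeData.sink true ∧
      Relation.ReflTransGen ((reducedOBDD e F hF).Step S) f t) ↔ f.1 S := by
    intro f
    induction f using (reducedOBDD e F hF).wellFounded_edge.induction with
    | _ f ih =>
      rcases hf : reducedNode e F f with b | ⟨x, c⟩
      · have hf' := (reducedNode_eq_sink e F).mp hf
        rw [hf']
        constructor
        · rintro ⟨t, ht, h⟩
          rcases Relation.ReflTransGen.cases_head h with rfl | ⟨g, ⟨x, d, h5, _⟩, _⟩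
          · rw [hf] at ht
            cases ht
            rfl
          · rw [show reducedNode e F f = _ from h5] at hf
            cases hf
        · intro h
          subst h
          exact ⟨f, hf, .refl⟩
      · have hf' := (reducedNode_eq_decision e F).mp hf
        have h1 := ih (c (S x)) ⟨x, c, S x, hf, rfl⟩
        have h2 : (c (S x)).1 S = f.1 S := by
          rw [hf'.2]
          exact congrArg f.1 (Function.update_eq_self x S)
        rw [← h2, ← h1]
        constructor
        · rintro ⟨t, ht, h⟩
          rcases Relation.ReflTransGen.cases_head h with rfl | ⟨g, ⟨y, d, h5, h6⟩, h7⟩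
          · rw [hf] at ht
            cases ht
          · rw [show reducedNode e F f = _ from h5] at hf
            cases hf
            exact ⟨t, ht, h6 ▸ h7⟩
        · rintro ⟨t, ht, h⟩
          exact ⟨t, ht, .head ⟨x, c, hf, rfl⟩ h⟩
  exact key _

end Reduced

/-! ### Small diagrams from orders with small boundary. -/

section Upper

variable {V : Type*} [Fintype V] {n : ℕ} (e : V ≃ Fin n) {G : SimpleGraph V}

theorem ncard_subfunctions_mem_obddSizes (hG : ∃ u v, G.Adj u v) :
    (subfunctions e (SatCNF G)).ncard ∈ obddSizes G := by
  classical
  have : Fintype (subfunctions e (SatCNF G)) := Fintype.ofFinite _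
  have hF : ∀ b : Bool, ∃ a, SatCNF G a = (b = true) := by
    obtain ⟨u, v, h⟩ := hG
    rintro (_ | _)
    · refine ⟨fun _ => false, eq_iff_iff.mpr ⟨fun h' => ?_, fun h' => by cases h'⟩⟩
      simpa using h' u v h
    · exact ⟨fun _ => true, eq_iff_iff.mpr ⟨fun _ => rfl, fun _ _ _ _ => Or.inl rfl⟩⟩
  rw [← Nat.card_coe_set_eq, Nat.card_eq_fintype_card]
  exact card_mem_obddSizes (reducedOBDD e (SatCNF G) hF) (reducedOBDD_accepts e _ hF)

theorem obddSizes_nonempty (hG : ∃ u v, G.Adj u v) : (obddSizes G).Nonempty :=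
  ⟨_, ncard_subfunctions_mem_obddSizes (Fintype.equivFin V) hG⟩

/-- If each prefix has at most `r` vertices with neighbours outside of it, then the diagram for
this order is small. -/
theorem obdd_le_of_boundary (hG : ∃ u v, G.Adj u v) (r : ℕ)
    (h : ∀ i ≤ n, {v | (e v).val < i ∧ ∃ w, i ≤ (e w).val ∧ G.Adj v w}.ncard ≤ r) :
    obdd G ≤ (n + 1) * (1 + 2 ^ r) := by
  classical
  refine (Nat.sInf_le (ncard_subfunctions_mem_obddSizes e hG)).trans ?_
  have hsub : subfunctions e (SatCNF G) ⊆
      ⋃ i ∈ Finset.range (n + 1), {f | ∃ a, f = subfunction e (SatCNF G) i a} := by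
    rintro f ⟨i, hi, h⟩
    simp only [Set.mem_iUnion, Finset.mem_range]
    exact ⟨i, by omega, h⟩
  have hlevel : ∀ i ∈ Finset.range (n + 1),
      {f | ∃ a, f = subfunction e (SatCNF G) i a}.ncard ≤ 1 + 2 ^ r := by
    intro i hi
    have hB := h i (by rw [Finset.mem_range] at hi; omega)
    set B := {v | (e v).val < i ∧ ∃ w, i ≤ (e w).val ∧ G.Adj v w} with hBdef
    -- Either `a` violates a clause inside the prefix, or its values off `B` may be reset to true:
    -- clauses inside the prefix stay satisfied, and clauses leaving it have their inner end in `B`.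
    have hsub : {f | ∃ a, f = subfunction e (SatCNF G) i a} ⊆ insert (fun _ => False)
        (Set.range fun β : B → Bool => subfunction e (SatCNF G) i
          fun v => if h : v ∈ B then β ⟨v, h⟩ else true) := by
      rintro f ⟨a, rfl⟩
      by_cases hbad : ∃ u v, G.Adj u v ∧ (e u).val < i ∧ (e v).val < i ∧ a u = false ∧ a v = false
      · left
        obtain ⟨u, v, huv, hu, hv, hau, hav⟩ := hbad
        funext S
        refine eq_false fun hS => ?_
        have := hS u v huv
        simp [hu, hv, hau, hav] at this
      · right
        push Not at hbad
        refine ⟨fun v => a v.1, ?_⟩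
        funext S
        refine eq_iff_iff.mpr (forall_congr' fun u => forall_congr' fun v => ?_)
        refine forall_congr' fun huv => ?_
        have hout : ∀ u v, G.Adj u v → (e u).val < i → ¬ (e v).val < i → u ∈ B :=
          fun u v huv h1 h2 => ⟨h1, v, not_lt.mp h2, huv⟩
        have hval := hbad u v huv
        by_cases h1 : (e u).val < i <;> by_cases h2 : (e v).val < i
        · have := hval h1 h2
          simp only [h1, h2, if_true]
          split_ifs <;> simp <;> grind
        · simp [h1, h2, hout u v huv h1 h2]
        · simp [h1, h2, hout v u huv.symm h2 h1]
        · simp [h1, h2]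
    refine (Set.ncard_le_ncard hsub (Set.toFinite _)).trans ((Set.ncard_insert_le _ _).trans ?_)
    rw [add_comm]
    refine Nat.add_le_add_left ?_ 1
    rw [← Set.image_univ]
    refine (Set.ncard_image_le (Set.toFinite _)).trans ?_
    rw [Set.ncard_univ, Nat.card_fun]
    simp only [Nat.card_eq_fintype_card, Fintype.card_bool]
    rw [← Nat.card_eq_fintype_card, Nat.card_coe_set_eq]
    exact Nat.pow_le_pow_right (by norm_num) hB
  refine (Set.ncard_le_ncard hsub (Set.toFinite _)).trans ?_
  refine (Finset.set_ncard_biUnion_le _ _).trans ?_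
  refine (Finset.sum_le_card_nsmul _ _ _ hlevel).trans ?_
  simp

end Upper

/-! ### Bounding the lu-mim width; crossing families. -/

section Lu

variable {V : Type*} {G : SimpleGraph V}

theorem upperMim_le {U : Set V} {b : ℕ}
    (h : ∀ M, IsInducedCutMatching (upperSubgraph G U) U M → M.card ≤ b) : upperMim G U ≤ b := by
  refine csSup_le' ?_
  rintro _ ⟨M, hM, rfl⟩
  exact h M hM

variable [Fintype V]

theorem card_le_upperMim {U : Set V} {M : Finset (V × V)}
    (hM : IsInducedCutMatching (upperSubgraph G U) U M) : M.card ≤ upperMim G U := by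
  refine le_csSup ⟨Fintype.card (V × V), ?_⟩ ⟨M, hM, rfl⟩
  rintro _ ⟨M', -, rfl⟩
  exact Finset.card_le_univ M'

theorem le_lu {b : ℕ}
    (h : ∀ π : Fin (Fintype.card V) ≃ V, ∃ i, b ≤ upperMim G (π '' {j | j ≤ i})) : b ≤ lu G := by
  have : Nonempty (Fin (Fintype.card V) ≃ V) := ⟨(Fintype.equivFin V).symm⟩
  refine le_ciInf fun π => ?_
  obtain ⟨i, hi⟩ := h π
  exact hi.trans (Finset.le_sup (f := fun i => upperMim G (π '' {j | j ≤ i})) (Finset.mem_univ i))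

theorem lu_le {α : Type*} [LinearOrder α] {ρ : V → α} (hρ : Function.Injective ρ) {b : ℕ}
    (h : ∀ w, upperMim G {v | ρ v ≤ ρ w} ≤ b) : lu G ≤ b := by
  obtain ⟨π, hπ⟩ := exists_equiv_image_Iic (LinearOrder.lift' ρ hρ)
  refine (ciInf_le (OrderBot.bddBelow _) π).trans (Finset.sup_le fun i _ => ?_)
  rw [hπ]
  exact h (π i)

/-- The edges `L t`, `R t` form an induced matching of `G^U` between `U` and its complement. -/
structure IsCrossingFamily {V : Type*} (G : SimpleGraph V) (U : Set V) {ι : Type*} (L R : ι → V) : Prop where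
  left_mem : ∀ t, L t ∈ U
  right_notMem : ∀ t, R t ∉ U
  adj : ∀ t, G.Adj (L t) (R t)
  not_adj_left : ∀ s t, s ≠ t → ¬ G.Adj (L s) (L t)
  not_adj : ∀ s t, s ≠ t → ¬ G.Adj (L s) (R t)

theorem IsCrossingFamily.card_le_upperMim {U : Set V} {ι : Type*} [Fintype ι] {L R : ι → V}
    (h : IsCrossingFamily G U L R) : Fintype.card ι ≤ upperMim G U := by
  classical
  have hL : ∀ s t, s ≠ t → L s ≠ L t := fun s t hst heq =>
    h.not_adj s t hst (heq ▸ h.adj t)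
  have hR : ∀ s t, s ≠ t → R s ≠ R t := fun s t hst heq =>
    h.not_adj s t hst (heq ▸ h.adj s)
  have hinj : Function.Injective fun t => (L t, R t) := fun s t hst => by
    by_contra hne
    exact hL s t hne (Prod.ext_iff.mp hst).1
  rw [← Finset.card_univ, ← Finset.card_image_of_injective _ hinj]
  refine _root_.card_le_upperMim ⟨?_, ?_⟩
  · simp only [Finset.mem_image, Finset.mem_univ, true_and]
    rintro _ ⟨t, rfl⟩
    exact ⟨h.left_mem t, h.right_notMem t, h.adj t, Or.inl (h.left_mem t)⟩
  · simp only [Finset.mem_image, Finset.mem_univ, true_and]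
    rintro _ ⟨s, rfl⟩ _ ⟨t, rfl⟩ hne
    have hst : s ≠ t := fun h => hne (by rw [h])
    refine ⟨hL s t hst, hR s t hst, fun h' => h.not_adj_left s t hst h'.1, ?_,
      fun h' => h.not_adj s t hst h'.1, fun h' => h.not_adj t s hst.symm h'.1.symm⟩
    -- Edges between right ends are harmless: both ends lie outside `U`, so `G^U` has dropped them.
    rintro ⟨-, h' | h'⟩
    · exact h.right_notMem s h'
    · exact h.right_notMem t h'

/-- The prefix at which the first of several nonempty sets is completed contains no other set of
the family that avoids its last vertex. -/
theorem exists_first_full {n : ℕ} (π : Fin n ≃ V) {ι : Type*} [Finite ι] [Nonempty ι]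
    (ℓ : ι → Set V) (hℓ : ∀ a, (ℓ a).Nonempty) :
    ∃ i a, ℓ a ⊆ π '' {j | j ≤ i} ∧ ∀ b, ℓ b ⊆ π '' {j | j ≤ i} → π i ∈ ℓ b := by
  have hlast : ∀ a, ∃ i, π i ∈ ℓ a ∧ ∀ v ∈ ℓ a, π.symm v ≤ i := by
    intro a
    obtain ⟨v, hv, hmax⟩ := Set.exists_max_image (ℓ a) π.symm (Set.toFinite _) (hℓ a)
    exact ⟨π.symm v, by simpa using hv, hmax⟩
  choose T hT hmax using hlast
  obtain ⟨a, ha⟩ := Finite.exists_min T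
  refine ⟨T a, a, fun v hv => ⟨π.symm v, hmax a v hv, by simp⟩, fun b hb => ?_⟩
  obtain ⟨j, hj, hjT⟩ := hb (hT b)
  rw [π.injective.eq_iff] at hjT
  subst hjT
  rw [le_antisymm (ha b) hj]
  exact hT b

end Lu

/-- A crossing family yields a family of independent sets with different neighbourhoods outside the
prefix: the sets of left ends of its subfamilies. -/
theorem IsCrossingFamily.exists_independent {V : Type*} [Fintype V] {G : SimpleGraph V} {U : Set V}
    {ι : Type*} {L R : ι → V} (h : IsCrossingFamily G U L R) :
    ∃ A : Finset ι → Set V, (∀ t, A t ⊆ U) ∧ (∀ t, ∀ u ∈ A t, ∀ v ∈ A t, ¬ G.Adj u v) ∧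
      (∀ s t, s ≠ t → ∃ v ∉ U, ¬ ((∃ u ∈ A s, G.Adj u v) ↔ ∃ u ∈ A t, G.Adj u v)) := by
  refine ⟨fun X => L '' X, ?_, ?_, ?_⟩
  · rintro X _ ⟨t, -, rfl⟩
    exact h.left_mem t
  · rintro X _ ⟨s, -, rfl⟩ _ ⟨t, -, rfl⟩ hadj
    by_cases hst : s = t
    · subst hst
      exact hadj.ne rfl
    · exact h.not_adj_left s t hst hadj
  · intro X Y hXY
    have hmem : ∀ (X : Finset ι) t, (∃ u ∈ L '' X, G.Adj u (R t)) ↔ t ∈ X := by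
      intro X t
      constructor
      · rintro ⟨_, ⟨s, hs, rfl⟩, hadj⟩
        by_cases hst : s = t
        · exact hst ▸ hs
        · exact absurd hadj (h.not_adj s t hst)
      · exact fun ht => ⟨_, ⟨t, ht, rfl⟩, h.adj t⟩
    by_contra hcon
    push Not at hcon
    refine hXY (Finset.ext fun t => ?_)
    rw [← hmem X t, ← hmem Y t]
    exact hcon (R t) (h.right_notMem t)

theorem iff_of_forall_succ_iff {P : ℕ → Prop} {lo hi : ℕ}
    (h : ∀ d, lo ≤ d → d + 1 < hi → (P d ↔ P (d + 1))) {a : ℕ} (ha : lo ≤ a) (ha' : a < hi) :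
    P a ↔ P lo := by
  induction a, ha using Nat.le_induction with
  | base => rfl
  | succ a ha ih => rw [← h a ha ha', ih (by omega)]

theorem exists_change {P : ℕ → Prop} {n a b : ℕ} (ha : a < n) (hb : b < n) (hPa : P a)
    (hPb : ¬ P b) : ∃ d, d + 1 < n ∧ ¬ (P d ↔ P (d + 1)) := by
  by_contra hcon
  push Not at hcon
  have h : ∀ d, 0 ≤ d → d + 1 < n → (P d ↔ P (d + 1)) := fun d _ hd => by
    have := hcon d hd
    tauto
  exact hPb ((iff_of_forall_succ_iff h (Nat.zero_le b) hb).mpr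
    ((iff_of_forall_succ_iff h (Nat.zero_le a) ha).mp hPa))

/-- A path with vertices in and outside of a set has an edge between the set and its complement. -/
theorem exists_pathGraph_adj {n : ℕ} {S : Set (Fin n)} {a b : Fin n} (ha : a ∈ S) (hb : b ∉ S) :
    ∃ x ∈ S, ∃ y ∉ S, (SimpleGraph.pathGraph n).Adj x y := by
  obtain ⟨d, hd, hchange⟩ := exists_change (P := fun d => ∃ h : d < n, (⟨d, h⟩ : Fin n) ∈ S)
    a.isLt b.isLt ⟨a.isLt, ha⟩ (fun ⟨_, h⟩ => hb h)
  by_cases h1 : (⟨d, by omega⟩ : Fin n) ∈ S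
  · refine ⟨_, h1, ⟨d + 1, hd⟩, fun h2 => hchange ?_, ?_⟩
    · exact ⟨fun _ => ⟨_, h2⟩, fun _ => ⟨_, h1⟩⟩
    · rw [SimpleGraph.pathGraph_adj]
      exact Or.inl rfl
  · refine ⟨⟨d + 1, hd⟩, ?_, _, h1, ?_⟩
    · by_contra h2
      exact hchange ⟨fun ⟨_, h⟩ => absurd h h1, fun ⟨_, h⟩ => absurd h h2⟩
    · rw [SimpleGraph.pathGraph_adj]
      exact Or.inr rfl

/-! ### Grids. -/

theorem gridGraph_adj {p r : ℕ} {x y : Fin p × Fin r} : (gridGraph p r).Adj x y ↔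
    ((x.1.val + 1 = y.1.val ∨ y.1.val + 1 = x.1.val) ∧ x.2 = y.2) ∨
    ((x.2.val + 1 = y.2.val ∨ y.2.val + 1 = x.2.val) ∧ x.1 = y.1) := by
  rw [gridGraph, SimpleGraph.boxProd_adj, SimpleGraph.pathGraph_adj, SimpleGraph.pathGraph_adj]

/-- In row-major order every edge spans at most `r` positions. Hence the inner ends of the edges
leaving a prefix are among its last `r` vertices, which bounds both the width and the boundary. -/
theorem gridGraph_rank_le {p r : ℕ} {x y : Fin p × Fin r} (h : (gridGraph p r).Adj x y) :
    (finProdFinEquiv y).val ≤ (finProdFinEquiv x).val + r := by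
  rw [gridGraph_adj] at h
  rw [finProdFinEquiv_apply_val, finProdFinEquiv_apply_val]
  have hx := x.2.isLt
  rcases h with ⟨h | h, h'⟩ | ⟨h | h, h'⟩
  · rw [h', ← h]
    ring_nf
    rfl
  · rw [h', ← h, mul_add]
    omega
  · rw [h']
    omega
  · rw [h']
    omega

theorem lu_gridGraph_le (p r : ℕ) : lu (gridGraph p r) ≤ r := by
  refine lu_le finProdFinEquiv.injective fun w => upperMim_le fun M hM => ?_
  obtain ⟨i, hi⟩ : ∃ i, i = (finProdFinEquiv w).val := ⟨_, rfl⟩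
  have hmaps : ∀ e ∈ M, (finProdFinEquiv e.1).val ∈ Finset.Ico (i + 1 - r) (i + 1) := by
    intro e he
    obtain ⟨h1, h2, h3, -⟩ := hM.1 e he
    have := gridGraph_rank_le h3
    simp only [Set.mem_ofPred_eq, Fin.le_def, ← hi] at h1 h2
    rw [Finset.mem_Ico]
    omega
  have hinj : Set.InjOn (fun e : (Fin p × Fin r) × (Fin p × Fin r) => (finProdFinEquiv e.1).val)
      M := by
    intro e he f hf hef
    by_contra hne
    exact (hM.2 e he f hf hne).1 (finProdFinEquiv.injective (Fin.ext hef))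
  refine (Finset.card_le_card_of_injOn _ hmaps hinj).trans ?_
  rw [Nat.card_Ico]
  omega

theorem exists_adj_gridGraph {p r : ℕ} (hr : 1 ≤ r) (hp : 2 ≤ p) :
    ∃ u v, (gridGraph p r).Adj u v :=
  ⟨(⟨0, by omega⟩, ⟨0, hr⟩), (⟨1, by omega⟩, ⟨0, hr⟩), gridGraph_adj.mpr (Or.inl ⟨Or.inl rfl, rfl⟩)⟩

theorem gridGraph_not_isolated {p r : ℕ} (hp : 2 ≤ p) (v : Fin p × Fin r) :
    ∃ w, (gridGraph p r).Adj v w := by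
  obtain ⟨⟨x, hx⟩, y⟩ := v
  by_cases h : x + 1 < p
  · exact ⟨(⟨x + 1, h⟩, y), gridGraph_adj.mpr (Or.inl ⟨Or.inl rfl, rfl⟩)⟩
  · exact ⟨(⟨x - 1, by omega⟩, y), gridGraph_adj.mpr (Or.inl ⟨Or.inr (by simp only; omega), rfl⟩)⟩

theorem obdd_gridGraph_le {p r : ℕ} (hr : 1 ≤ r) (hp : 2 ≤ p) :
    obdd (gridGraph p r) ≤ (p * r + 1) * (1 + 2 ^ r) := by
  refine obdd_le_of_boundary finProdFinEquiv (exists_adj_gridGraph hr hp) r fun i _ => ?_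
  have : (Set.ncard ((Finset.Ico (i - r) i : Finset ℕ) : Set ℕ)) ≤ r := by
    rw [Set.ncard_coe_finset, Nat.card_Ico]
    omega
  refine le_trans ?_ this
  refine Set.ncard_le_ncard_of_injOn (fun v => (finProdFinEquiv v).val) ?_ ?_ (Set.toFinite _)
  · rintro v ⟨hv, w, hw, hvw⟩
    have := gridGraph_rank_le hvw
    simp only [Finset.coe_Ico, Set.mem_Ico]
    omega
  · exact fun v _ w _ h => finProdFinEquiv.injective (Fin.ext h)

theorem one_le_lu {V : Type*} [Fintype V] {G : SimpleGraph V} (h : ∃ u v, G.Adj u v) :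
    1 ≤ lu G := by
  refine le_lu fun π => ?_
  have key : ∀ u v, G.Adj u v → π.symm u < π.symm v → ∃ i, 1 ≤ upperMim G (π '' {j | j ≤ i}) := by
    intro u v huv hlt
    refine ⟨π.symm u, ?_⟩
    have hf : IsCrossingFamily G (π '' {j | j ≤ π.symm u}) (fun _ : Unit => u) (fun _ => v) := by
      refine ⟨fun _ => ⟨π.symm u, le_refl (π.symm u), by simp⟩, ?_, fun _ => huv, fun s t h => absurd rfl h,
        fun s t h => absurd rfl h⟩
      rintro - ⟨j, hj, rfl⟩
      rw [π.symm_apply_apply] at hlt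
      exact absurd hj (not_le.mpr hlt)
    exact hf.card_le_upperMim
  obtain ⟨u, v, huv⟩ := h
  rcases lt_trichotomy (π.symm u) (π.symm v) with hlt | heq | hlt
  · exact key u v huv hlt
  · exact absurd (π.symm.injective heq) huv.ne
  · exact key v u huv.symm hlt

/-- When the first line is complete, a crossing line that avoids the last vertex is incomplete but
meets the complete one, so it contains an edge across the prefix. Pairwise non-adjacent crossing
lines make these edges an induced matching; `r ≤ p` supplies enough of them in both directions. -/
theorem half_le_lu_gridGraph {p r : ℕ} (hr : 1 ≤ r) (hrp : r ≤ p) :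
    r / 2 ≤ lu (gridGraph p r) := by
  refine le_lu fun π => ?_
  have : Nonempty (Fin p ⊕ Fin r) := ⟨Sum.inr ⟨0, hr⟩⟩
  obtain ⟨i, a, hfull, hfirst⟩ := exists_first_full π
    (Sum.elim (fun a : Fin p => {v : Fin p × Fin r | v.1 = a}) fun b => {v | v.2 = b}) (by
      rintro (a | b)
      · exact ⟨(a, ⟨0, hr⟩), rfl⟩
      · exact ⟨(⟨0, by omega⟩, b), rfl⟩)
  refine ⟨i, ?_⟩
  generalize hU : π '' {j | j ≤ i} = U at *
  suffices h : ∃ L R : Fin (r / 2) → Fin p × Fin r, IsCrossingFamily (gridGraph p r) U L R by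
    obtain ⟨L, R, h⟩ := h
    simpa using h.card_le_upperMim
  rcases a with a | b
  -- The chosen columns have the parity opposite to that of the column of `π i`: they avoid the last
  -- vertex and no two are adjacent.
  · have hmix : ∀ m : Fin (r / 2), ∃ x y : Fin p × Fin r, x ∈ U ∧ y ∉ U ∧
        x.2.val = 2 * m.val + (1 - (π i).2.val % 2) ∧ x.2 = y.2 ∧ (gridGraph p r).Adj x y := by
      intro m
      have hm := m.isLt
      obtain ⟨b, hb⟩ : ∃ b : Fin r, b.val = 2 * m.val + (1 - (π i).2.val % 2) :=
        ⟨⟨2 * m.val + (1 - (π i).2.val % 2), by omega⟩, rfl⟩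
      have hne : ¬ {v : Fin p × Fin r | v.2 = b} ⊆ U := by
        intro hsub
        have h1 : (π i).2 = b := hfirst (Sum.inr b) hsub
        have h2 := congrArg Fin.val h1
        omega
      obtain ⟨⟨x, b'⟩, rfl, hx⟩ := Set.not_subset.mp hne
      obtain ⟨y, hy, z, hz, hyz⟩ := exists_pathGraph_adj (S := {x | (x, b') ∈ U}) (a := a) (b := x)
        (hfull rfl) hx
      refine ⟨(y, b'), (z, b'), hy, hz, hb, rfl, ?_⟩
      rw [gridGraph, SimpleGraph.boxProd_adj]
      exact Or.inl ⟨hyz, rfl⟩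
    choose L R hL hR hval hLR hadj using hmix
    refine ⟨L, R, hL, hR, hadj, fun s t hst h => ?_, fun s t hst h => ?_⟩
    · rw [gridGraph_adj] at h
      have h1 := hval s
      have h2 := hval t
      have h3 := Fin.val_ne_of_ne hst
      rcases h with ⟨-, h⟩ | ⟨h, -⟩
      · rw [h] at h1
        omega
      · omega
    · rw [gridGraph_adj, ← hLR] at h
      have h1 := hval s
      have h2 := hval t
      have h3 := Fin.val_ne_of_ne hst
      rcases h with ⟨-, h⟩ | ⟨h, -⟩
      · rw [h] at h1
        omega
      · omega
  -- The same with rows and columns exchanged.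
  · have hmix : ∀ m : Fin (r / 2), ∃ x y : Fin p × Fin r, x ∈ U ∧ y ∉ U ∧
        x.1.val = 2 * m.val + (1 - (π i).1.val % 2) ∧ x.1 = y.1 ∧ (gridGraph p r).Adj x y := by
      intro m
      have hm := m.isLt
      obtain ⟨a, ha⟩ : ∃ a : Fin p, a.val = 2 * m.val + (1 - (π i).1.val % 2) :=
        ⟨⟨2 * m.val + (1 - (π i).1.val % 2), by omega⟩, rfl⟩
      have hne : ¬ {v : Fin p × Fin r | v.1 = a} ⊆ U := by
        intro hsub
        have h1 : (π i).1 = a := hfirst (Sum.inl a) hsub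
        have h2 := congrArg Fin.val h1
        omega
      obtain ⟨⟨a', x⟩, rfl, hx⟩ := Set.not_subset.mp hne
      obtain ⟨y, hy, z, hz, hyz⟩ := exists_pathGraph_adj (S := {x | (a', x) ∈ U}) (a := b) (b := x)
        (hfull rfl) hx
      refine ⟨(a', y), (a', z), hy, hz, ha, rfl, ?_⟩
      rw [gridGraph, SimpleGraph.boxProd_adj]
      exact Or.inr ⟨hyz, rfl⟩
    choose L R hL hR hval hLR hadj using hmix
    refine ⟨L, R, hL, hR, hadj, fun s t hst h => ?_, fun s t hst h => ?_⟩
    · rw [gridGraph_adj] at h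
      have h1 := hval s
      have h2 := hval t
      have h3 := Fin.val_ne_of_ne hst
      rcases h with ⟨h, -⟩ | ⟨-, h⟩
      · omega
      · rw [h] at h1
        omega
    · rw [gridGraph_adj, ← hLR] at h
      have h1 := hval s
      have h2 := hval t
      have h3 := Fin.val_ne_of_ne hst
      rcases h with ⟨h, -⟩ | ⟨-, h⟩
      · omega
      · rw [h] at h1
        omega

theorem le_three_mul_lu_gridGraph {p r : ℕ} (hr : 1 ≤ r) (hrp : r ≤ p) (hp : 2 ≤ p) :
    r ≤ 3 * lu (gridGraph p r) := by
  have h1 := half_le_lu_gridGraph hr hrp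
  have h2 := one_le_lu (exists_adj_gridGraph hr hp)
  omega

/-! ### Grids of skewed graphs: adjacency and coordinates. -/

section SkewGrid

variable {p q r : ℕ}

theorem skewGrid_adj_main {x y : Fin p × Fin r × Fin q} :
    (skewGrid p q r).Adj (Sum.inl x) (Sum.inl y) ↔
      (x.1.val + 1 = y.1.val ∧ x.2.1 = y.2.1 ∧ x.2.2 ≤ y.2.2) ∨
      (y.1.val + 1 = x.1.val ∧ y.2.1 = x.2.1 ∧ y.2.2 ≤ x.2.2) := by
  obtain ⟨i, k, j⟩ := x
  obtain ⟨i', k', j'⟩ := y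
  simp only [skewGrid, SimpleGraph.fromRel_adj, skewRel, and_iff_right_iff_imp]
  rintro (⟨h, -⟩ | ⟨h, -⟩) heq <;> cases heq <;> omega

theorem skewGrid_adj_main_aux {x : Fin p × Fin r × Fin q} {y : Fin p × Fin (r * q - 1)} :
    (skewGrid p q r).Adj (Sum.inl x) (Sum.inr y) ↔
      x.1 = y.1 ∧ (x.2.1.val * q + x.2.2.val = y.2.val ∨
        x.2.1.val * q + x.2.2.val = y.2.val + 1) := by
  obtain ⟨i, k, j⟩ := x
  obtain ⟨i', d⟩ := y
  simp [skewGrid, SimpleGraph.fromRel_adj, skewRel]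

theorem not_skewGrid_adj_aux {x y : Fin p × Fin (r * q - 1)} :
    ¬ (skewGrid p q r).Adj (Sum.inr x) (Sum.inr y) := by
  simp [skewGrid, SimpleGraph.fromRel_adj, skewRel]

theorem coord_symm (c : Fin (r * q)) :
    (finProdFinEquiv.symm c).1.val * q + (finProdFinEquiv.symm c).2.val = c.val := by
  conv_rhs => rw [← finProdFinEquiv.apply_symm_apply c, finProdFinEquiv_apply_val]
  rw [mul_comm, add_comm]

theorem symm_coord (k : Fin r) (j : Fin q) (h : k.val * q + j.val < r * q) :
    finProdFinEquiv.symm ⟨k.val * q + j.val, h⟩ = (k, j) := by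
  rw [Equiv.symm_apply_eq]
  refine Fin.ext ?_
  rw [finProdFinEquiv_apply_val]
  ring

theorem coord_lt (k : Fin r) (j : Fin q) : k.val * q + j.val < r * q := by
  have h1 := j.isLt
  have h2 : (k.val + 1) * q ≤ r * q := Nat.mul_le_mul_right q k.isLt
  rw [add_mul, one_mul] at h2
  omega

theorem exists_skewGrid_adj_main (hp : 2 ≤ p) (v : Fin p × Fin r × Fin q) :
    ∃ w, (skewGrid p q r).Adj (Sum.inl v) w := by
  obtain ⟨⟨i, hi⟩, k, j⟩ := v
  by_cases h : i + 1 < p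
  · exact ⟨Sum.inl (⟨i + 1, h⟩, k, j), skewGrid_adj_main.mpr (Or.inl ⟨rfl, rfl, le_rfl⟩)⟩
  · exact ⟨Sum.inl (⟨i - 1, by omega⟩, k, j),
      skewGrid_adj_main.mpr (Or.inr ⟨by simp only; omega, rfl, le_rfl⟩)⟩

theorem skewGrid_not_isolated (hp : 2 ≤ p) (v : SkewVertex p q r) :
    ∃ w, (skewGrid p q r).Adj v w := by
  rcases v with v | ⟨i, d⟩
  · exact exists_skewGrid_adj_main hp v
  · refine ⟨Sum.inl (i, finProdFinEquiv.symm ⟨d, by omega⟩), SimpleGraph.Adj.symm ?_⟩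
    exact skewGrid_adj_main_aux.mpr ⟨rfl, Or.inl (coord_symm _)⟩

/-! ### Upper bound for the width of the grid of skewed graphs. -/

section Upper

/-- The layer of a vertex and its position in the subdivided path of this layer. -/
def skewRank : SkewVertex p q r → ℕ ×ₗ ℕ
  | Sum.inl (i, k, j) => toLex (i.val, 2 * (k.val * q + j.val))
  | Sum.inr (i, d) => toLex (i.val, 2 * d.val + 1)

theorem skewRank_injective : Function.Injective (skewRank (p := p) (q := q) (r := r)) := by
  rintro (⟨i, k, j⟩ | ⟨i, d⟩) (⟨i', k', j'⟩ | ⟨i', d'⟩) h <;>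
    simp only [skewRank, EmbeddingLike.apply_eq_iff_eq, Prod.mk.injEq] at h
  · have h1 : k.val * q + j.val = k'.val * q + j'.val := by omega
    have h2 : (k, j) = (k', j') := by
      rw [← symm_coord k j (coord_lt k j), ← symm_coord k' j' (coord_lt k' j')]
      simp only [h1]
    rw [Fin.ext h.1, h2]
  · omega
  · omega
  · rw [Fin.ext h.1, Fin.ext (by omega : d.val = d'.val)]

/-- For an edge between two layers, whether it starts in the layer `i₀`, and the path of skewed
graphs that it belongs to. An induced matching across a prefix that ends in the layer `i₀` is mapped
injectively. -/
def skewEdgeType (i₀ : ℕ) : SkewVertex p q r × SkewVertex p q r → Option (Bool × Fin r)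
  | (Sum.inl (i, k, _), Sum.inl _) => some (decide (i.val = i₀), k)
  | _ => none

/-- Order the vertices layer by layer. A matching across a prefix has at most one edge inside a
layer, and at most one edge per path of skewed graphs on each side of the current layer, in total `2
* r + 1 ≤ 3 * r`. -/
theorem lu_skewGrid_le (hr : 1 ≤ r) : lu (skewGrid p q r) ≤ 3 * r := by
  refine lu_le skewRank_injective fun w => upperMim_le fun M hM => ?_
  obtain ⟨i₀, t₀, hw⟩ : ∃ i₀ t₀, skewRank w = toLex (i₀, t₀) := ⟨_, _, rfl⟩
  rw [hw] at hM
  have hinj : Set.InjOn (skewEdgeType i₀) (M : Set (SkewVertex p q r × SkewVertex p q r)) := by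
    -- Edges inside a layer join consecutive positions, so the inner end of one that is cut is the
    -- last vertex of the prefix.
    have hcases : ∀ x ∈ M, ∀ o, skewEdgeType i₀ x = o →
        (o = none ∧ skewRank x.1 = toLex (i₀, t₀)) ∨
        ∃ (i i' : Fin p) (k : Fin r) (j j' : Fin q), x = (Sum.inl (i, k, j), Sum.inl (i', k, j')) ∧
          i.val + 1 = i'.val ∧ j ≤ j' ∧ o = some (decide (i.val = i₀), k) ∧
          (i.val = i₀ ∨ i.val + 1 = i₀) := by
      rintro ⟨x, y⟩ hxy _ rfl
      obtain ⟨h1, h2, h3, -⟩ := hM.1 _ hxy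
      rcases x with ⟨i, k, j⟩ | ⟨i, d⟩ <;> rcases y with ⟨i', k', j'⟩ | ⟨i', d'⟩
      · right
        rw [skewGrid_adj_main] at h3
        simp only [Set.mem_ofPred_eq, skewRank, Prod.Lex.toLex_le_toLex] at h1 h2
        rcases h3 with ⟨h3, h4, h5⟩ | ⟨h3, h4, h5⟩
        · simp only at h3 h4 h5
          subst h4
          exact ⟨i, i', k, j, j', rfl, h3, h5, rfl, by omega⟩
        · simp only at h3
          omega
      · left
        rw [skewGrid_adj_main_aux] at h3
        simp only [Set.mem_ofPred_eq, skewRank, Prod.Lex.toLex_le_toLex] at h1 h2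
        obtain ⟨h3, h4⟩ := h3
        simp only at h3 h4
        subst h3
        refine ⟨rfl, ?_⟩
        simp only [skewRank, EmbeddingLike.apply_eq_iff_eq, Prod.mk.injEq]
        omega
      · left
        have h3 := h3.symm
        rw [skewGrid_adj_main_aux] at h3
        simp only [Set.mem_ofPred_eq, skewRank, Prod.Lex.toLex_le_toLex] at h1 h2
        obtain ⟨h3, h4⟩ := h3
        simp only at h3 h4
        subst h3
        refine ⟨rfl, ?_⟩
        simp only [skewRank, EmbeddingLike.apply_eq_iff_eq, Prod.mk.injEq]
        omega
      · exact absurd h3 not_skewGrid_adj_aux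
    intro x hx y hy hxy
    by_contra hne
    obtain ⟨h1, -, -, -, h2, h3⟩ := hM.2 x hx y hy hne
    rcases hcases x hx _ rfl with ⟨hx1, hx2⟩ | ⟨i, i', k, j, j', hx1, hx2, hx3, hx4, hx5⟩ <;>
    rcases hcases y hy _ hxy.symm with ⟨hy1, hy2⟩ | ⟨l, l', m, s, s', hy1, hy2, hy3, hy4, hy5⟩
    · exact h1 (skewRank_injective (hx2.trans hy2.symm))
    · rw [hx1] at hy4
      cases hy4
    · rw [hx4] at hy1
      cases hy1
    · rw [hx4] at hy4
      simp only [Option.some.injEq, Prod.mk.injEq, decide_eq_decide] at hy4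
      obtain ⟨hil, rfl⟩ := hy4
      have hx6 := (hM.1 x hx).1
      have hy6 := (hM.1 y hy).1
      subst hx1 hy1
      -- For two edges of one skewed graph, the left end with the smaller index is adjacent to both
      -- right ends, so the matching is not induced.
      rcases le_total j s with hjs | hjs
      · refine h2 ⟨skewGrid_adj_main.mpr (Or.inl ⟨?_, rfl, hjs.trans hy3⟩), Or.inl hx6⟩
        simp only
        omega
      · refine h3 ⟨skewGrid_adj_main.mpr (Or.inr ⟨?_, rfl, hjs.trans hx3⟩), Or.inr hy6⟩
        simp only
        omega
  have := Finset.card_le_card_of_injOn (t := Finset.univ) _ (fun _ _ => Finset.mem_univ _) hinj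
  simp only [Finset.card_univ, Fintype.card_option, Fintype.card_prod, Fintype.card_bool,
    Fintype.card_fin] at this
  omega

end Upper

/-! ### Prefixes with many changes or with large skewed graphs across them. -/

section Lower

/-- The main vertex of coordinate `c` of the `i`-th layer belongs to `U`. -/
def MainMem (U : Set (SkewVertex p q r)) (i : Fin p) (c : ℕ) : Prop :=
  ∃ h : c < r * q, Sum.inl (i, finProdFinEquiv.symm ⟨c, h⟩) ∈ U

theorem mainMem_coord {U : Set (SkewVertex p q r)} {i : Fin p} {k : Fin r} {j : Fin q} :
    MainMem U i (k.val * q + j.val) ↔ Sum.inl (i, k, j) ∈ U := by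
  constructor
  · rintro ⟨h, hU⟩
    rwa [symm_coord] at hU
  · intro hU
    exact ⟨coord_lt k j, by rwa [symm_coord]⟩

open Classical in
/-- The pairs of consecutive main vertices of a layer that are separated by `U`. -/
noncomputable def changes (U : Set (SkewVertex p q r)) : Finset (Fin p × Fin (r * q - 1)) :=
  Finset.univ.filter fun x => ¬ (MainMem U x.1 x.2.val ↔ MainMem U x.1 (x.2.val + 1))

theorem mem_changes {U : Set (SkewVertex p q r)} {x : Fin p × Fin (r * q - 1)} :
    x ∈ changes U ↔ ¬ (MainMem U x.1 x.2.val ↔ MainMem U x.1 (x.2.val + 1)) := by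
  simp [changes]

/-- The vertex is the one that subdivides the edge after the coordinate `x.2` of the layer `x.1`, or
an end of this edge. -/
def Near (x : Fin p × Fin (r * q - 1)) : SkewVertex p q r → Prop
  | Sum.inl (i, k, j) =>
      i = x.1 ∧ (k.val * q + j.val = x.2.val ∨ k.val * q + j.val = x.2.val + 1)
  | Sum.inr y => y = x

/-- The subdividing vertex is on the other side than one of its two separated neighbours. -/
theorem exists_crossing_of_mem_changes {U : Set (SkewVertex p q r)} {x : Fin p × Fin (r * q - 1)}
    (hx : x ∈ changes U) :
    ∃ u v, u ∈ U ∧ v ∉ U ∧ (skewGrid p q r).Adj u v ∧ Near x u ∧ Near x v := by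
  rw [mem_changes] at hx
  obtain ⟨i, d⟩ := x
  have hd := d.isLt
  set a : SkewVertex p q r := Sum.inl (i, finProdFinEquiv.symm ⟨d, by omega⟩) with ha
  set b : SkewVertex p q r := Sum.inl (i, finProdFinEquiv.symm ⟨d + 1, by omega⟩) with hb
  have h1 : MainMem U i d ↔ a ∈ U := ⟨fun ⟨_, h⟩ => h, fun h => ⟨_, h⟩⟩
  have h2 : MainMem U i (d + 1) ↔ b ∈ U := ⟨fun ⟨_, h⟩ => h, fun h => ⟨_, h⟩⟩
  simp only [h1, h2] at hx
  have haN : Near (i, d) a := ⟨rfl, Or.inl (coord_symm _)⟩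
  have hbN : Near (i, d) b := ⟨rfl, Or.inr (coord_symm _)⟩
  have haA : (skewGrid p q r).Adj a (Sum.inr (i, d)) :=
    skewGrid_adj_main_aux.mpr ⟨rfl, Or.inl (coord_symm _)⟩
  have hbA : (skewGrid p q r).Adj b (Sum.inr (i, d)) :=
    skewGrid_adj_main_aux.mpr ⟨rfl, Or.inr (coord_symm _)⟩
  have hcN : Near (i, d) (Sum.inr (i, d) : SkewVertex p q r) := rfl
  by_cases hc : (Sum.inr (i, d) : SkewVertex p q r) ∈ U
  · by_cases h : a ∈ U
    · exact ⟨_, b, hc, by tauto, hbA.symm, hcN, hbN⟩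
    · exact ⟨_, a, hc, h, haA.symm, hcN, haN⟩
  · by_cases h : a ∈ U
    · exact ⟨a, _, h, hc, haA, haN, hcN⟩
    · exact ⟨b, _, by tauto, hc, hbA, hbN, hcN⟩

/-- With equal layer parities no edge joins consecutive layers. Within one layer, the coordinates
differ by at least two, so no main vertex near one change is adjacent to the subdividing vertex of
the other. -/
theorem Near.not_adj {x y : Fin p × Fin (r * q - 1)} (hne : x ≠ y)
    (h1 : x.1.val % 2 = y.1.val % 2) (h2 : x.2.val % 2 = y.2.val % 2) {u v : SkewVertex p q r}
    (hu : Near x u) (hv : Near y v) : ¬ (skewGrid p q r).Adj u v := by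
  intro hadj
  rcases u with ⟨i, k, j⟩ | x' <;> rcases v with ⟨i', k', j'⟩ | y'
  · obtain ⟨rfl, -⟩ := hu
    obtain ⟨rfl, -⟩ := hv
    rw [skewGrid_adj_main] at hadj
    simp only at hadj
    omega
  · obtain rfl : y' = y := hv
    obtain ⟨rfl, hu⟩ := hu
    obtain ⟨h3, h4⟩ := skewGrid_adj_main_aux.mp hadj
    simp only at h3 h4
    exact hne (Prod.ext h3 (Fin.ext (by omega)))
  · obtain rfl : x' = x := hu
    obtain ⟨rfl, hv⟩ := hv
    obtain ⟨h3, h4⟩ := skewGrid_adj_main_aux.mp hadj.symm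
    simp only at h3 h4
    exact hne (Prod.ext h3.symm (Fin.ext (by omega)))
  · exact not_skewGrid_adj_aux hadj

/-- A quarter of the changes is far apart and yields an induced matching. -/
theorem exists_crossingFamily_of_changes (U : Set (SkewVertex p q r)) :
    ∃ (ι : Type) (_ : Fintype ι) (L R : ι → SkewVertex p q r),
      IsCrossingFamily (skewGrid p q r) U L R ∧ (changes U).card / 4 ≤ Fintype.card ι := by
  classical
  obtain ⟨y, -, hy⟩ := Finset.exists_le_card_fiber_of_mul_le_card_of_maps_to (s := changes U)
    (t := Finset.range 2 ×ˢ Finset.range 2) (n := (changes U).card / 4)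
    (f := fun x => (x.1.val % 2, x.2.val % 2)) (by
      intro x _
      simp only [Finset.mem_product, Finset.mem_range]
      omega) (by simp) (by simp; omega)
  have hmem : ∀ x : {x // x ∈ (changes U).filter fun x => (x.1.val % 2, x.2.val % 2) = y},
      x.1 ∈ changes U ∧ x.1.1.val % 2 = y.1 ∧ x.1.2.val % 2 = y.2 := by
    rintro ⟨x, hx⟩
    obtain ⟨h1, h2⟩ := Finset.mem_filter.mp hx
    exact ⟨h1, congrArg Prod.fst h2, congrArg Prod.snd h2⟩
  choose L R hL hR hadj hLN hRN using fun x => exists_crossing_of_mem_changes (hmem x).1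
  refine ⟨_, inferInstance, L, R, ⟨hL, hR, hadj, fun s t hst => ?_, fun s t hst => ?_⟩, ?_⟩
  · exact (hLN s).not_adj (fun h => hst (Subtype.ext h)) ((hmem s).2.1.trans (hmem t).2.1.symm)
      ((hmem s).2.2.trans (hmem t).2.2.symm) (hLN t)
  · exact (hLN s).not_adj (fun h => hst (Subtype.ext h)) ((hmem s).2.1.trans (hmem t).2.1.symm)
      ((hmem s).2.2.trans (hmem t).2.2.symm) (hRN t)
  · rwa [Fintype.card_coe]

/-- With few changes, each path of skewed graphs has a long interval of coordinates in which no
layer changes. -/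
theorem exists_constant_block {U : Set (SkewVertex p q r)} {T w : ℕ} (hT : (changes U).card < T)
    (hw : T * w ≤ q) (k : Fin r) :
    ∃ lo, lo + w ≤ q ∧ ∀ i, ∀ t < w,
      (MainMem U i (k.val * q + lo + t) ↔ MainMem U i (k.val * q + lo)) := by
  by_contra hcon
  push Not at hcon
  -- Cut the coordinates into `T` disjoint blocks of length `w`. If each contained a change, in
  -- whatever layer, there would be `T` changes.
  have hbad : ∀ β : Fin T, ∃ x ∈ changes U, ∃ d < w, x.2.val = k.val * q + (w * β.val + d) := by
    intro β
    have hβ : w * β.val + w ≤ q := by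
      have : (β.val + 1) * w ≤ T * w := Nat.mul_le_mul_right w β.isLt
      rw [add_mul, one_mul, mul_comm] at this
      omega
    obtain ⟨i, t, ht, hne⟩ := hcon (w * β.val) hβ
    by_contra hno
    push Not at hno
    have hcoord := coord_lt k (⟨w * β.val + (w - 1), by omega⟩ : Fin q)
    simp only at hcoord
    have hsucc : ∀ d, k.val * q + w * β.val ≤ d → d + 1 < k.val * q + w * β.val + w →
        (MainMem U i d ↔ MainMem U i (d + 1)) := by
      intro d hd hd'
      by_contra hch
      refine hno (i, ⟨d, by omega⟩) (mem_changes.mpr hch) (d - (k.val * q + w * β.val)) (by omega) ?_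
      simp only
      omega
    have hconst := iff_of_forall_succ_iff hsucc (a := k.val * q + w * β.val + t) (by omega)
      (by omega)
    tauto
  choose x hx d hd hxd using hbad
  have hinj : Function.Injective fun β : Fin T => (⟨x β, hx β⟩ : {x // x ∈ changes U}) := by
    intro β γ h
    have h1 : x β = x γ := congrArg Subtype.val h
    have h2 : w * β.val + d β = w * γ.val + d γ := by
      have h3 := hxd β
      rw [h1, hxd γ] at h3
      omega
    have hw0 : 0 < w := lt_of_le_of_lt (Nat.zero_le _) (hd β)
    have h4 := congrArg (· / w) h2
    simp only [Nat.mul_add_div hw0, Nat.div_eq_of_lt (hd β), Nat.div_eq_of_lt (hd γ)] at h4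
    exact Fin.ext (by omega)
  have := Fintype.card_le_of_injective _ hinj
  rw [Fintype.card_fin, Fintype.card_coe] at this
  omega

/-- Between a layer in `U` and a layer outside of `U`, each path of skewed graphs has a large skewed
graph across `U` if there are few changes. -/
theorem exists_halfGraph {U : Set (SkewVertex p q r)} {T w : ℕ} (hT : (changes U).card < T)
    (hw : T * w ≤ q) (hw0 : 0 < w) {a b : Fin p} (ha : ∀ c < r * q, MainMem U a c)
    (hb : ∀ c, ¬ MainMem U b c) (k : Fin r) :
    ∃ L R : Fin w → SkewVertex p q r, (∀ t, L t ∈ U ∧ R t ∉ U ∧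
      (∃ i j, L t = Sum.inl (i, k, j)) ∧ ∃ i j, R t = Sum.inl (i, k, j)) ∧
      ((∀ s t, (skewGrid p q r).Adj (L s) (R t) ↔ s ≤ t) ∨
        ∀ s t, (skewGrid p q r).Adj (L s) (R t) ↔ t ≤ s) := by
  obtain ⟨lo, hlo, hconst⟩ := exists_constant_block hT hw k
  have hlt := coord_lt k (⟨lo, by omega⟩ : Fin q)
  -- Somewhere between the full and the empty layer, the block switches sides from layer `d` to `d +
  -- 1`, entirely since it is constant. Which of the two layers lies in `U` decides the orientation
  -- of the skewed graph.
  obtain ⟨d, hd, hne⟩ := exists_change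
    (P := fun i => ∃ h : i < p, MainMem U ⟨i, h⟩ (k.val * q + lo)) a.isLt b.isLt
    ⟨a.isLt, ha _ hlt⟩ (fun ⟨_, h⟩ => hb _ h)
  set v : Fin p → Fin w → SkewVertex p q r := fun i t => Sum.inl (i, k, ⟨lo + t.val, by omega⟩)
    with hv
  have hmem : ∀ i t, v i t ∈ U ↔ MainMem U i (k.val * q + lo) := by
    intro i t
    rw [← hconst i t.val t.isLt, hv, ← mainMem_coord, add_assoc]
  have hadj : ∀ s t, (skewGrid p q r).Adj (v ⟨d, by omega⟩ s) (v ⟨d + 1, hd⟩ t) ↔ s ≤ t := by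
    intro s t
    rw [hv, skewGrid_adj_main]
    constructor
    · rintro (⟨-, -, h⟩ | ⟨h, -⟩)
      · exact Nat.le_of_add_le_add_left h
      · simp only at h
        omega
    · exact fun h => Or.inl ⟨rfl, rfl, Nat.add_le_add_left h lo⟩
  by_cases h : MainMem U ⟨d, by omega⟩ (k.val * q + lo)
  · refine ⟨v ⟨d, by omega⟩, v ⟨d + 1, hd⟩, fun t => ⟨(hmem _ t).mpr h, fun h' => hne ?_,
      ⟨_, _, rfl⟩, ⟨_, _, rfl⟩⟩, Or.inl hadj⟩
    exact ⟨fun _ => ⟨hd, (hmem _ t).mp h'⟩, fun _ => ⟨_, h⟩⟩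
  · refine ⟨v ⟨d + 1, hd⟩, v ⟨d, by omega⟩, fun t => ⟨(hmem _ t).mpr ?_, fun h' => h ((hmem _ t).mp h'),
      ⟨_, _, rfl⟩, ⟨_, _, rfl⟩⟩, Or.inr fun s t => by rw [SimpleGraph.adj_comm, hadj]⟩
    by_contra h'
    exact hne ⟨fun ⟨_, h1⟩ => absurd h1 h, fun ⟨_, h1⟩ => absurd h1 h'⟩

theorem not_adj_of_column_ne {u v : SkewVertex p q r} {k l : Fin r} (hkl : k ≠ l)
    (hu : ∃ i j, u = Sum.inl (i, k, j)) (hv : ∃ i j, v = Sum.inl (i, l, j)) :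
    ¬ (skewGrid p q r).Adj u v := by
  obtain ⟨i, j, rfl⟩ := hu
  obtain ⟨i', j', rfl⟩ := hv
  rw [skewGrid_adj_main]
  rintro (⟨-, h, -⟩ | ⟨-, h, -⟩)
  · exact hkl h
  · exact hkl h.symm

/-- Skewed graphs across `U` in all paths of skewed graphs yield an induced matching and a family of
independent sets with different neighbourhoods. -/
theorem exists_families_of_halfGraphs {U : Set (SkewVertex p q r)} {w : ℕ} (hw0 : 0 < w)
    (h : ∀ k : Fin r, ∃ L R : Fin w → SkewVertex p q r, (∀ t, L t ∈ U ∧ R t ∉ U ∧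
      (∃ i j, L t = Sum.inl (i, k, j)) ∧ ∃ i j, R t = Sum.inl (i, k, j)) ∧
      ((∀ s t, (skewGrid p q r).Adj (L s) (R t) ↔ s ≤ t) ∨
        ∀ s t, (skewGrid p q r).Adj (L s) (R t) ↔ t ≤ s)) :
    (∃ L R : Fin r → SkewVertex p q r, IsCrossingFamily (skewGrid p q r) U L R) ∧
    ∃ A : (Fin r → Fin w) → Set (SkewVertex p q r), (∀ t, A t ⊆ U) ∧
      (∀ t, ∀ u ∈ A t, ∀ v ∈ A t, ¬ (skewGrid p q r).Adj u v) ∧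
      (∀ s t, s ≠ t → ∃ v ∉ U, ¬ ((∃ u ∈ A s, (skewGrid p q r).Adj u v) ↔
        ∃ u ∈ A t, (skewGrid p q r).Adj u v)) := by
  choose L R hLR hadj using h
  have hLL : ∀ k l s t, k ≠ l → ¬ (skewGrid p q r).Adj (L k s) (L l t) := fun k l s t hkl =>
    not_adj_of_column_ne hkl (hLR k s).2.2.1 (hLR l t).2.2.1
  have hLRne : ∀ k l s t, k ≠ l → ¬ (skewGrid p q r).Adj (L k s) (R l t) := fun k l s t hkl =>
    not_adj_of_column_ne hkl (hLR k s).2.2.1 (hLR l t).2.2.2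
  refine ⟨⟨fun k => L k ⟨0, hw0⟩, fun k => R k ⟨0, hw0⟩, fun k => (hLR k _).1,
    fun k => (hLR k _).2.1, fun k => ?_, fun k l hkl => hLL k l _ _ hkl,
    fun k l hkl => hLRne k l _ _ hkl⟩, fun t => Set.range fun k => L k (t k), ?_, ?_, ?_⟩
  · rcases hadj k with h | h
    · exact (h _ _).mpr le_rfl
    · exact (h _ _).mpr le_rfl
  · rintro t _ ⟨k, rfl⟩
    exact (hLR k _).1
  · rintro t _ ⟨k, rfl⟩ _ ⟨l, rfl⟩ hkl
    by_cases h : k = l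
    · subst h
      exact hkl.ne rfl
    · exact hLL k l _ _ h hkl
  · intro s t hst
    obtain ⟨k, hk⟩ := Function.ne_iff.mp hst
    have key : ∀ (t : Fin r → Fin w) x, (∃ u ∈ Set.range fun k => L k (t k),
        (skewGrid p q r).Adj u (R k x)) ↔ (skewGrid p q r).Adj (L k (t k)) (R k x) := by
      intro t x
      constructor
      · rintro ⟨_, ⟨l, rfl⟩, hl⟩
        by_cases h : l = k
        · subst h
          exact hl
        · exact absurd hl (hLRne l k _ _ h)
      · exact fun h => ⟨_, ⟨k, rfl⟩, h⟩
    -- Of the two left vertices, exactly one is adjacent to the right vertex with the smaller index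
    -- if adjacency is `s ≤ t`, and to the one with the larger index if it is `t ≤ s`.
    rcases lt_or_gt_of_ne hk with hlt | hlt <;> rcases hadj k with h | h
    · refine ⟨R k (s k), (hLR k _).2.1, ?_⟩
      rw [key, key, h, h]
      simp [hlt]
    · refine ⟨R k (t k), (hLR k _).2.1, ?_⟩
      rw [key, key, h, h]
      simp [hlt]
    · refine ⟨R k (t k), (hLR k _).2.1, ?_⟩
      rw [key, key, h, h]
      simp [hlt]
    · refine ⟨R k (s k), (hLR k _).2.1, ?_⟩
      rw [key, key, h, h]
      simp [hlt]

/-- Each ordering has a prefix with many changes or with skewed graphs across it in all paths of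
skewed graphs. -/
theorem exists_prefix_skewGrid {T w n : ℕ} (hr : 1 ≤ r) (hp : T + 1 ≤ p) (hw : T * w ≤ q)
    (hw0 : 0 < w) (hq : 0 < q) (π : Fin n ≃ SkewVertex p q r) :
    ∃ i, (∃ (ι : Type) (_ : Fintype ι) (L R : ι → SkewVertex p q r),
        IsCrossingFamily (skewGrid p q r) (π '' {j | j ≤ i}) L R ∧ T / 4 ≤ Fintype.card ι) ∨
      ((∃ L R : Fin r → SkewVertex p q r,
        IsCrossingFamily (skewGrid p q r) (π '' {j | j ≤ i}) L R) ∧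
      ∃ A : (Fin r → Fin w) → Set (SkewVertex p q r), (∀ t, A t ⊆ π '' {j | j ≤ i}) ∧
        (∀ t, ∀ u ∈ A t, ∀ v ∈ A t, ¬ (skewGrid p q r).Adj u v) ∧
        (∀ s t, s ≠ t → ∃ v ∉ π '' {j | j ≤ i}, ¬ ((∃ u ∈ A s, (skewGrid p q r).Adj u v) ↔
          ∃ u ∈ A t, (skewGrid p q r).Adj u v))) := by
  have : Nonempty (Fin p) := ⟨⟨0, by omega⟩⟩
  obtain ⟨i, a, hfull, hfirst⟩ := exists_first_full π
    (fun a : Fin p => {v : SkewVertex p q r | ∃ x, v = Sum.inl (a, x)})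
    (fun a => ⟨Sum.inl (a, ⟨0, hr⟩, ⟨0, hq⟩), _, rfl⟩)
  refine ⟨i, ?_⟩
  generalize hU : π '' {j | j ≤ i} = U at *
  by_cases hT : T ≤ (changes U).card
  · left
    obtain ⟨ι, hι, L, R, h1, h2⟩ := exists_crossingFamily_of_changes U
    exact ⟨ι, hι, L, R, h1, (Nat.div_le_div_right hT).trans h2⟩
  · right
    rw [not_le] at hT
    obtain ⟨b, hb⟩ : ∃ b, ∀ c, ¬ MainMem U b c := by
      by_contra hcon
      push Not at hcon
      -- Layers are disjoint and `π i` lies in layer `a`, so no other layer is full. If none were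
      -- empty, each of the other `p - 1 ≥ T` layers would contain a change.
      have hall : Finset.univ ⊆ insert a ((changes U).image Prod.fst) := by
        intro b _
        rw [Finset.mem_insert, Finset.mem_image]
        by_cases hba : b = a
        · exact Or.inl hba
        right
        have hne : ¬ {v : SkewVertex p q r | ∃ x, v = Sum.inl (b, x)} ⊆ U := by
          intro hsub
          obtain ⟨x, hx⟩ := hfirst a hfull
          obtain ⟨y, hy⟩ := hfirst b hsub
          rw [hx] at hy
          cases hy
          exact hba rfl
        obtain ⟨_, ⟨⟨k, j⟩, rfl⟩, hv⟩ := Set.not_subset.mp hne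
        rw [← mainMem_coord] at hv
        obtain ⟨c, hc⟩ := hcon b
        obtain ⟨d, hd, hch⟩ := exists_change hc.1 (coord_lt k j) hc hv
        exact ⟨(b, ⟨d, by omega⟩), mem_changes.mpr hch, rfl⟩
      have h1 := (Finset.card_le_card hall).trans (Finset.card_insert_le _ _)
      have h2 := Finset.card_image_le (s := changes U) (f := Prod.fst)
      rw [Finset.card_univ, Fintype.card_fin] at h1
      omega
    exact exists_families_of_halfGraphs hw0
      (exists_halfGraph hT hw hw0 (fun c hc => ⟨hc, hfull ⟨_, rfl⟩⟩) hb)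

end Lower

end SkewGrid

/-! ### Choice of the parameters and asymptotics. -/

theorem obdd_gridGraph_le_mul_two_pow {p r : ℕ} (hr : 1 ≤ r) (hp : 2 ≤ p) :
    obdd (gridGraph p r) ≤ p * r * 2 ^ (3 * r) := by
  refine (obdd_gridGraph_le hr hp).trans ?_
  have h1 : 1 ≤ p * r := Nat.mul_pos (by omega) hr
  have h2 : 1 ≤ 2 ^ r := Nat.one_le_two_pow
  have h3 : 2 ^ 2 ≤ (2 ^ r) ^ 2 := Nat.pow_le_pow_left (Nat.le_self_pow (by omega) 2) 2
  calc (p * r + 1) * (1 + 2 ^ r) ≤ (2 * (p * r)) * (2 * 2 ^ r) :=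
        Nat.mul_le_mul (by omega) (by omega)
    _ = p * r * (2 ^ 2 * 2 ^ r) := by ring
    _ ≤ p * r * ((2 ^ r) ^ 2 * 2 ^ r) := by gcongr
    _ = p * r * 2 ^ (3 * r) := by ring

theorem obdd_gridGraph_le_two_pow {p r : ℕ} (hr : 1 ≤ r) (hp : 2 ≤ p) (hpr : p ≤ 2 ^ r) :
    obdd (gridGraph p r) ≤ 2 ^ (5 * r) := by
  refine (obdd_gridGraph_le_mul_two_pow hr hp).trans ?_
  calc p * r * 2 ^ (3 * r) ≤ 2 ^ r * 2 ^ r * 2 ^ (3 * r) := by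
        gcongr
        exact Nat.lt_two_pow_self.le
    _ = 2 ^ (5 * r) := by ring

theorem le_lu_skewGrid {p q r T w : ℕ} (hr : 1 ≤ r) (hp : T + 1 ≤ p) (hw : T * w ≤ q)
    (hw0 : 0 < w) (hq : 0 < q) (hT : 4 * r ≤ T) : r ≤ lu (skewGrid p q r) := by
  refine le_lu fun π => ?_
  obtain ⟨i, ⟨ι, _, L, R, h, hι⟩ | ⟨⟨L, R, h⟩, -⟩⟩ := exists_prefix_skewGrid hr hp hw hw0 hq π
  · have := h.card_le_upperMim
    exact ⟨i, by omega⟩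
  · exact ⟨i, by simpa using h.card_le_upperMim⟩

theorem le_of_mem_obddSizes_skewGrid {p q r T w m : ℕ} (hr : 1 ≤ r) (hp : T + 1 ≤ p)
    (hw : T * w ≤ q) (hw0 : 0 < w) (hq : 0 < q) (hm : m ∈ obddSizes (skewGrid p q r)) :
    2 ^ (T / 4) ≤ m ∨ w ^ r ≤ m := by
  obtain ⟨π, hπ⟩ := exists_perm_card_le_of_mem_obddSizes hm
  obtain ⟨i, ⟨ι, _, L, R, h, hι⟩ | ⟨-, A, h1, h2, h3⟩⟩ := exists_prefix_skewGrid hr hp hw hw0 hq π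
  · obtain ⟨A, h1, h2, h3⟩ := h.exists_independent
    have := hπ i A h1 h2 h3
    rw [Fintype.card_finset] at this
    exact Or.inl ((Nat.pow_le_pow_right (by norm_num) hι).trans this)
  · have := hπ i A h1 h2 h3
    rw [Fintype.card_fun, Fintype.card_fin, Fintype.card_fin] at this
    exact Or.inr this

theorem card_skewVertex_le {p q r : ℕ} : Fintype.card (SkewVertex p q r) ≤ 2 * p * r * q := by
  simp only [Fintype.card_sum, Fintype.card_prod, Fintype.card_fin]
  have : p * (r * q - 1) ≤ p * (r * q) := Nat.mul_le_mul_left p (Nat.sub_le _ _)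
  calc _ ≤ p * (r * q) + p * (r * q) := by omega
    _ = _ := by ring

/-- Apply the dichotomy with `T = r * L` and `w = Nat.sqrt q`. Here `n ≤ q ^ 2`, and each
alternative bounds `q ^ (2 * r)` by the 16th power of the size. -/
theorem card_pow_le_obdd_skewGrid {p q r : ℕ} (hr : 1 ≤ r) (hp : p = 2 * r * Nat.clog 2 q)
    (hL : 4 ≤ Nat.clog 2 q) (hrL : r * Nat.clog 2 q ≤ Nat.sqrt q) :
    r ≤ lu (skewGrid p q r) ∧
      Fintype.card (SkewVertex p q r) ^ r ≤ obdd (skewGrid p q r) ^ 16 := by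
  set L := Nat.clog 2 q with hLdef
  set w := Nat.sqrt q with hwdef
  have hT4 : 4 * r ≤ r * L := by nlinarith
  have hw4 : 4 ≤ w := by omega
  have hww : w * w ≤ q := Nat.sqrt_le q
  have hw : r * L * w ≤ q := (Nat.mul_le_mul_right w hrL).trans hww
  have hq : 0 < q := by nlinarith
  have hp' : r * L + 1 ≤ p := by
    rw [hp, mul_assoc]
    omega
  refine ⟨le_lu_skewGrid hr hp' hw (by omega) hq hT4, ?_⟩
  have hadj : ∃ u v, (skewGrid p q r).Adj u v :=
    ⟨_, exists_skewGrid_adj_main (by omega) (⟨0, by omega⟩, ⟨0, hr⟩, ⟨0, hq⟩)⟩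
  -- Since some diagram exists, the infimum is attained and is not the default value `0`.
  have hmem : obdd (skewGrid p q r) ∈ obddSizes (skewGrid p q r) :=
    Nat.sInf_mem (obddSizes_nonempty hadj)
  have hn : Fintype.card (SkewVertex p q r) ≤ q ^ 2 := by
    calc _ ≤ 2 * p * r * q := card_skewVertex_le
      _ = (r * (4 * r * L)) * q := by rw [hp]; ring
      _ ≤ (r * (L * r * L)) * q := by gcongr
      _ = (r * L) * (r * L) * q := by ring
      _ ≤ w * w * q := by gcongr
      _ ≤ q * q := by gcongr
      _ = q ^ 2 := by ring
  have hqL : q ≤ 2 ^ L := Nat.le_pow_clog (by norm_num) q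
  have hqw : q ≤ w ^ 4 := by
    have h1 : q < (w + 1) * (w + 1) := Nat.lt_succ_sqrt q
    have h2 : w + 1 ≤ w * w := by nlinarith
    calc q ≤ (w + 1) * (w + 1) := h1.le
      _ ≤ (w * w) * (w * w) := Nat.mul_le_mul h2 h2
      _ = w ^ 4 := by ring
  refine (Nat.pow_le_pow_left hn r).trans ?_
  rcases le_of_mem_obddSizes_skewGrid hr hp' hw (by omega) hq hmem with h | h
  · calc (q ^ 2) ^ r ≤ ((2 ^ L) ^ 2) ^ r := by gcongr
      _ = 2 ^ (2 * (r * L)) := by ring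
      -- Rounding down costs at most a factor of two, as `4 ≤ r * L`.
      _ ≤ 2 ^ (r * L / 4 * 16) := Nat.pow_le_pow_right (by norm_num) (by omega)
      _ = (2 ^ (r * L / 4)) ^ 16 := by rw [pow_mul]
      _ ≤ _ := Nat.pow_le_pow_left h 16
  · calc (q ^ 2) ^ r ≤ ((w ^ 4) ^ 2) ^ r := by gcongr
      _ = (w ^ r) ^ 8 := by ring
      _ ≤ (w ^ r) ^ 16 := Nat.pow_le_pow_right (by positivity) (by norm_num)
      _ ≤ _ := Nat.pow_le_pow_left h 16

theorem exists_forall_mul_clog_le_sqrt (r : ℕ) :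
    ∃ q₀, ∀ q ≥ q₀, 4 ≤ Nat.clog 2 q ∧ r * Nat.clog 2 q ≤ Nat.sqrt q := by
  -- `L ^ 2 = o(2 ^ L)`; the factor `2` in the constant pays for `q > 2 ^ (L - 1)`, and `r + 1`
  -- keeps the denominator positive.
  have h := (isLittleO_pow_const_const_pow_of_one_lt (R := ℝ) 2 (one_lt_two)).def
    (c := 1 / (2 * ((r : ℝ) + 1) ^ 2)) (by positivity)
  obtain ⟨L₀, hL₀⟩ := Filter.eventually_atTop.mp h
  refine ⟨2 ^ (L₀ + 4), fun q hq => ?_⟩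
  have hL : L₀ + 4 ≤ Nat.clog 2 q := by
    have := Nat.clog_mono_right 2 hq
    rwa [Nat.clog_pow 2 _ (by norm_num)] at this
  refine ⟨by omega, ?_⟩
  have h1 := hL₀ (Nat.clog 2 q) (by omega)
  have h2 : 2 ^ (Nat.clog 2 q).pred < q :=
    Nat.pow_pred_clog_lt_self (by norm_num)
      (lt_of_lt_of_le (Nat.one_lt_two_pow (by omega)) hq)
  generalize Nat.clog 2 q = L at *
  obtain ⟨l, rfl⟩ : ∃ l, L = l + 1 := ⟨L - 1, by omega⟩
  rw [Nat.pred_succ] at h2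
  rw [Nat.le_sqrt]
  refine le_trans ?_ h2.le
  rw [Real.norm_of_nonneg (by positivity), Real.norm_of_nonneg (by positivity), one_div,
    inv_mul_eq_div, le_div_iff₀ (by positivity)] at h1
  have h3 : (((r * (l + 1)) * (r * (l + 1)) : ℕ) : ℝ) ≤ (2 ^ l : ℕ) := by
    push_cast at h1 ⊢
    have h4 : (r : ℝ) ^ 2 ≤ (r + 1) ^ 2 := by gcongr; linarith
    have h5 : (r : ℝ) ^ 2 * (l + 1) ^ 2 ≤ (r + 1) ^ 2 * (l + 1) ^ 2 := by gcongr
    rw [pow_succ (2 : ℝ) l] at h1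
    nlinarith
  exact_mod_cast h3

theorem one_lt_card_skewVertex {p q r : ℕ} (hp : 2 ≤ p) (hr : 1 ≤ r) (hq : 1 ≤ q) :
    1 < Fintype.card (SkewVertex p q r) := by
  simp only [Fintype.card_sum, Fintype.card_prod, Fintype.card_fin]
  have : 1 ≤ r * q := Nat.mul_pos hr hq
  nlinarith

theorem rpow_le_of_pow_le_pow {n r m : ℕ} (h : n ^ r ≤ m ^ 16) :
    (n : ℝ) ^ ((1 / 16 : ℝ) * r) ≤ m := by
  have h1 : ((n : ℝ) ^ r) ≤ (m : ℝ) ^ 16 := by exact_mod_cast h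
  calc (n : ℝ) ^ ((1 / 16 : ℝ) * r) = ((n : ℝ) ^ r) ^ (1 / 16 : ℝ) := by
        rw [mul_comm, Real.rpow_mul (by positivity), Real.rpow_natCast]
    _ ≤ ((m : ℝ) ^ 16) ^ (1 / 16 : ℝ) := by gcongr
    _ = m := by
        rw [← Real.rpow_natCast, ← Real.rpow_mul (by positivity)]
        norm_num

theorem theorem3 :
    -- the grids
    (∃ a b C : ℝ, 0 < a ∧ 0 < b ∧ 0 < C ∧ ∀ r p : ℕ, 1 ≤ r → r ≤ p → 2 ≤ p →
      a * r ≤ lu (gridGraph p r) ∧ (lu (gridGraph p r) : ℝ) ≤ b * r ∧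
      (obddSizes (gridGraph p r)).Nonempty ∧
      (obdd (gridGraph p r) : ℝ) ≤ Fintype.card (Fin p × Fin r) * (2 : ℝ) ^ (C * r) ∧
      (p ≤ 2 ^ r → (obdd (gridGraph p r) : ℝ) ≤ (2 : ℝ) ^ (C * r))) ∧
    -- the grids of skewed graphs
    (∃ a b c : ℝ, 0 < a ∧ 0 < b ∧ 0 < c ∧ ∀ r : ℕ, 1 ≤ r → ∃ q₀ : ℕ, ∀ q p : ℕ, q₀ ≤ q →
      p = 2 * r * Nat.clog 2 q →
      a * r ≤ lu (skewGrid p q r) ∧ (lu (skewGrid p q r) : ℝ) ≤ b * r ∧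
      (Fintype.card (SkewVertex p q r) : ℝ) ^ (c * r) ≤ obdd (skewGrid p q r)) ∧
    -- no lower bound with a superlinear exponent
    (∃ C : ℝ, 0 < C ∧ ∀ f : ℕ → ℝ,
      (∀ (V : Type) [Fintype V] [Nonempty V] (G : SimpleGraph V), (∀ v, ∃ w, G.Adj v w) →
        (2 : ℝ) ^ f (lu G) ≤ obdd G) →
      ∃ᶠ k : ℕ in Filter.atTop, f k ≤ C * k) ∧
    -- no upper bound with a sublinear exponent
    (∃ c : ℝ, 0 < c ∧ ∀ g : ℕ → ℝ,
      (∀ (V : Type) [Fintype V] [Nonempty V] (G : SimpleGraph V), (∀ v, ∃ w, G.Adj v w) →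
        (obdd G : ℝ) ≤ (Fintype.card V : ℝ) ^ g (lu G)) →
      ∃ᶠ k : ℕ in Filter.atTop, c * k ≤ g k) := by
  refine ⟨⟨1 / 3, 1, 5, by norm_num, by norm_num, by norm_num, ?_⟩,
    ⟨1, 3, 1 / 16, by norm_num, by norm_num, by norm_num, ?_⟩,
    ⟨15, by norm_num, ?_⟩, ⟨1 / 48, by norm_num, ?_⟩⟩
  · intro r p hr hrp hp
    have h1 : (r : ℝ) ≤ 3 * lu (gridGraph p r) := by
      exact_mod_cast le_three_mul_lu_gridGraph hr hrp hp
    have h2 : (lu (gridGraph p r) : ℝ) ≤ r := by exact_mod_cast lu_gridGraph_le p r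
    refine ⟨by linarith, by linarith, obddSizes_nonempty (exists_adj_gridGraph hr hp), ?_, ?_⟩
    · have h3 : (obdd (gridGraph p r) : ℝ) ≤ (p * r : ℕ) * (2 : ℝ) ^ (3 * r) := by
        exact_mod_cast obdd_gridGraph_le_mul_two_pow hr hp
      simp only [Fintype.card_prod, Fintype.card_fin]
      refine h3.trans ?_
      rw [← Real.rpow_natCast]
      push_cast
      gcongr
      · norm_num
      · norm_num
    · intro hpr
      have h3 : (obdd (gridGraph p r) : ℝ) ≤ (2 : ℝ) ^ (5 * r) := by
        exact_mod_cast obdd_gridGraph_le_two_pow hr hp hpr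
      rw [← Real.rpow_natCast] at h3
      exact_mod_cast h3
  · intro r hr
    obtain ⟨q₀, hq₀⟩ := exists_forall_mul_clog_le_sqrt r
    refine ⟨q₀, fun q p hq hp => ?_⟩
    obtain ⟨h1, h2⟩ := hq₀ q hq
    obtain ⟨h3, h4⟩ := card_pow_le_obdd_skewGrid hr hp h1 h2
    refine ⟨?_, ?_, rpow_le_of_pow_le_pow h4⟩
    · rw [one_mul]
      exact_mod_cast h3
    · exact_mod_cast lu_skewGrid_le hr
  · intro f hf
    rw [Filter.frequently_atTop]
    intro K
    -- With `r ≤ 3 * lu` this makes the width exceed `K`; the exponent `5 * r` is then at most `15 *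
    -- lu`. Taking `max r 2` rows avoids the edgeless `1 × 1` grid.
    set r := 3 * K + 1 with hr
    have h1 : 1 ≤ r := by omega
    have hp : 2 ≤ max r 2 := le_max_right _ _
    have hpr : max r 2 ≤ 2 ^ r :=
      max_le Nat.lt_two_pow_self.le (Nat.le_self_pow (by omega) 2)
    have h2 := le_three_mul_lu_gridGraph h1 (le_max_left r 2) hp
    refine ⟨lu (gridGraph (max r 2) r), by omega, ?_⟩
    have : Nonempty (Fin (max r 2) × Fin r) := ⟨(⟨0, by omega⟩, ⟨0, by omega⟩)⟩
    have h3 := hf _ (gridGraph (max r 2) r) (gridGraph_not_isolated hp)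
    have h4 : (obdd (gridGraph (max r 2) r) : ℝ) ≤ (2 : ℝ) ^ (5 * r) := by
      exact_mod_cast obdd_gridGraph_le_two_pow h1 hp hpr
    rw [← Real.rpow_natCast] at h4
    have h5 := (Real.rpow_le_rpow_left_iff one_lt_two).mp (h3.trans h4)
    have h6 : (r : ℝ) ≤ 3 * lu (gridGraph (max r 2) r) := by exact_mod_cast h2
    push_cast at h5
    linarith
  · intro g hg
    rw [Filter.frequently_atTop]
    intro K
    have hr : 1 ≤ K + 1 := by omega
    obtain ⟨q, hq⟩ := exists_forall_mul_clog_le_sqrt (K + 1)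
    obtain ⟨h1, h2⟩ := hq (q + 1) (by omega)
    obtain ⟨p, hp⟩ : ∃ p, p = 2 * (K + 1) * Nat.clog 2 (q + 1) := ⟨_, rfl⟩
    have hp2 : 2 ≤ p := by nlinarith
    obtain ⟨h3, h4⟩ := card_pow_le_obdd_skewGrid hr hp h1 h2
    refine ⟨lu (skewGrid p (q + 1) (K + 1)), by omega, ?_⟩
    have hcard := one_lt_card_skewVertex (q := q + 1) hp2 hr (by omega)
    have : Nonempty (SkewVertex p (q + 1) (K + 1)) := Fintype.card_pos_iff.mp (by omega)
    have h5 := hg _ (skewGrid p (q + 1) (K + 1)) (skewGrid_not_isolated hp2)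
    -- As `n > 1`, the exponents compare: `(K + 1) / 16 ≤ g (lu G)`. With `lu G ≤ 3 * (K + 1)` this
    -- gives the constant `1 / 48`.
    have h6 := (Real.rpow_le_rpow_left_iff (by exact_mod_cast hcard)).mp
      ((rpow_le_of_pow_le_pow h4).trans h5)
    have h7 : (lu (skewGrid p (q + 1) (K + 1)) : ℝ) ≤ 3 * ((K + 1 : ℕ) : ℝ) := by
      exact_mod_cast lu_skewGrid_le hr
    linarith
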